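/- Let $\mathbb{T}=\mathbb{R}/\mathbb{Z}$. A flow $(X,T)$ is a compact Hausdorff space $X$ with a homeomorphism $T:X\to X$. It is minimal if every orbit $\{T^nx:n\in\mathbb{Z}\}$ is dense, uniquely ergodic if it has exactly one $T$-invariant regular Borel probability measure, and strictly ergodic if it is minimal and uniquely ergodic. A metric flow is distal if $\inf_{n\in\mathbb{Z}}d(T^nx,T^ny)>0$ whenever $x\neq y$. For points $x\in X$, $y\in Y$ of flows $(X,T)$, $(Y,R)$, the flow $(X,x)\vee(Y,y)$ is the restriction of $T\times R$ to the closure of the orbit $\{(T^nx,R^ny):n\in\mathbb{Z}\}$ in $X\times Y$. The enveloping semigroup $E(X,T)$ is the closure of $\{T^n:n\in\mathbb{Z}\}$ in $X^X$ with the topology of pointwise convergence; it is a $T$-flow under $p\mapsto T\circ p$. **Corollary 4.2.** There are real numbers $\alpha,\beta$ with $1,\alpha,\beta$ linearly independent over $\mathbb{Q}$, and a continuous function $h:\mathbb{T}\to\mathbb{R}$, such that with $\varphi(x)=h(x)+\beta \pmod 1$ the map $$S:\mathbb{T}^3\to\mathbb{T}^3,\qquad S(x,y,z)=(x+\alpha,\;y+\varphi(x),\;z+x),$$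 defines a flow $(W,S)$, $W=\mathbb{T}^3$, with the following properties. 1. $(W,S)$ is a distal and strictly ergodic metric flow. 2. The $2$-fold self-joining $(W,(0,0,0))\vee(W,(\beta,0,0))$ is minimal but not strictly ergodic. 3. The enveloping semigroup $E(W,S)$ is a group under composition, and $E(W,S)$ is not strictly ergodic as an $S$-flow. -/

import Mathlib

open MeasureTheory

namespace TopFlow

section Basic

variable {X : Type*} [TopologicalSpace X]

/-- A flow `(X, T)` is minimal if the two-sided orbit of every point is dense. -/
def IsMinimal (T : X ≃ₜ X) : Prop :=
  ∀ x : X, Dense (Set.range fun n : ℤ => (T ^ n) x)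

/-- `(X, T)` is uniquely ergodic if it has exactly one `T`-invariant regular Borel probability
measure. The σ-algebra is the Borel one (on a metrizable compact space regularity is automatic). -/
def IsUniquelyErgodic (T : X ≃ₜ X) : Prop :=
  letI : MeasurableSpace X := borel X
  ∃! μ : Measure X, IsProbabilityMeasure μ ∧ μ.Regular ∧ MeasurePreserving T μ μ

/-- A flow is strictly ergodic if it is uniquely ergodic and minimal. -/
def IsStrictlyErgodic (T : X ≃ₜ X) : Prop :=
  IsUniquelyErgodic T ∧ IsMinimal T

/-- The closure of the two-sided orbit of a point. -/
def orbitClosure (T : X ≃ₜ X) (x : X) : Set X :=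
  closure (Set.range fun n : ℤ => (T ^ n) x)

theorem mem_orbitClosure_iff (T : X ≃ₜ X) (x y : X) :
    y ∈ orbitClosure T x ↔ T y ∈ orbitClosure T x := by
  have h : T ⁻¹' orbitClosure T x = orbitClosure T x := by
    unfold orbitClosure
    rw [T.preimage_closure]
    congr 1
    ext z
    constructor
    · rintro ⟨n, hn⟩
      refine ⟨-1 + n, ?_⟩
      apply T.injective
      rw [← hn, ← Homeomorph.mul_apply, ← zpow_one_add]
      simp
    · rintro ⟨n, rfl⟩
      exact ⟨1 + n, by simp [zpow_one_add]⟩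
  exact (Set.ext_iff.1 h y).symm

/-- The subflow of `(X, T)` carried by the orbit closure of `x`. -/
def orbitFlow (T : X ≃ₜ X) (x : X) : orbitClosure T x ≃ₜ orbitClosure T x :=
  T.subtype (mem_orbitClosure_iff T x)

/-- The space of the pointed sup `(X, x, T) ∨ (Y, y, R)`: the orbit closure of `(x, y)` in the
product flow `(X × Y, T × R)`. -/
def supSpace {Y : Type*} [TopologicalSpace Y] (T : X ≃ₜ X) (x : X) (R : Y ≃ₜ Y) (y : Y) :
    Set (X × Y) :=
  orbitClosure (T.prodCongr R) (x, y)

/-- The homeomorphism of the pointed sup `(X, x, T) ∨ (Y, y, R)`, the restriction of `T × R`. -/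
def supFlow {Y : Type*} [TopologicalSpace Y] (T : X ≃ₜ X) (x : X) (R : Y ≃ₜ Y) (y : Y) :
    supSpace T x R y ≃ₜ supSpace T x R y :=
  orbitFlow (T.prodCongr R) (x, y)

/-- The enveloping semigroup `E(X, T)`: the closure of `{T ^ n : n ∈ ℤ}` in `X → X`, which carries
the topology of pointwise convergence. -/
def envelopingSemigroup (T : X ≃ₜ X) : Set (X → X) :=
  closure (Set.range fun n : ℤ => ((T ^ n : X ≃ₜ X) : X → X))

/-- Left multiplication `p ↦ T ∘ p` on `X → X`. -/
def leftMul (T : X ≃ₜ X) : (X → X) ≃ₜ (X → X) :=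
  Homeomorph.piCongrRight fun _ : X => T

theorem leftMul_apply (T : X ≃ₜ X) (p : X → X) : leftMul T p = T ∘ p := rfl

theorem leftMul_mem_iff (T : X ≃ₜ X) (p : X → X) :
    p ∈ envelopingSemigroup T ↔ leftMul T p ∈ envelopingSemigroup T := by
  have h : leftMul T ⁻¹' envelopingSemigroup T = envelopingSemigroup T := by
    unfold envelopingSemigroup
    rw [(leftMul T).preimage_closure]
    congr 1
    ext q
    constructor
    · rintro ⟨n, hn⟩
      refine ⟨-1 + n, ?_⟩
      apply (leftMul T).injective
      rw [← hn, leftMul_apply]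
      ext x
      rw [Function.comp_apply, ← Homeomorph.mul_apply, ← zpow_one_add]
      simp
    · rintro ⟨n, rfl⟩
      refine ⟨1 + n, ?_⟩
      ext x
      simp [zpow_one_add, leftMul_apply]
  exact (Set.ext_iff.1 h p).symm

/-- The enveloping semigroup as a `T`-flow: `T` acts by `p ↦ T ∘ p`. -/
def envelopingFlow (T : X ≃ₜ X) : envelopingSemigroup T ≃ₜ envelopingSemigroup T :=
  (leftMul T).subtype (leftMul_mem_iff T)

end Basic

/-- A set of self-maps is a group of bijections under composition. -/
def IsCompositionGroup {X : Type*} (E : Set (X → X)) : Prop :=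
  id ∈ E ∧ (∀ p ∈ E, ∀ q ∈ E, p ∘ q ∈ E) ∧ ∀ p ∈ E, ∃ q ∈ E, p ∘ q = id ∧ q ∘ p = id

/-- A metric flow is distal if distinct points have orbits which stay a positive distance apart. -/
def IsDistal {X : Type*} [MetricSpace X] (T : X ≃ₜ X) : Prop :=
  ∀ x y : X, x ≠ y → 0 < ⨅ n : ℤ, dist ((T ^ n) x) ((T ^ n) y)

/-- The homeomorphism `S(x, y, z) = (x + α, y + φ(x), z + x)` of the torus `(ℝ/ℤ)³`. -/
def torusMap (α : ℝ) (φ : C(UnitAddCircle, UnitAddCircle)) :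
    UnitAddCircle × UnitAddCircle × UnitAddCircle ≃ₜ
      UnitAddCircle × UnitAddCircle × UnitAddCircle where
  toFun w := (w.1 + (α : UnitAddCircle), w.2.1 + φ w.1, w.2.2 + w.1)
  invFun w := (w.1 - (α : UnitAddCircle), w.2.1 - φ (w.1 - (α : UnitAddCircle)),
    w.2.2 - (w.1 - (α : UnitAddCircle)))
  left_inv w := by simp
  right_inv w := by simp
  continuous_toFun := by fun_prop
  continuous_invFun := by fun_prop

end TopFlow

open Filter Topology

/-! ### Invariant measures and Birkhoff averages -/

section InvariantMeasures

variable {X : Type*} [TopologicalSpace X]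

/-! The function `h` is a uniform limit of coboundaries G_k(x + α) - G_k(x) whose transfer functions
G_k are small and Cauchy in L¹, although G_k(0) = k/2. In the mean `h` behaves like a coboundary,
but along the orbit of 0 it does not. For n < N_k the ergodic sum S_n h(0) is close to G_k(nα) -
k/2, so the averages of cos(2π S_n h(0)) up to N_k (k ≥ 1) have sign (-1)^k and modulus at least
1/2. This is `exists_limit_of_coboundaries`.

Strict ergodicity of S sees only the L¹ behaviour. An invariant measure projects to Lebesgue measure
on the first circle. S multiplies a character of the torus by a function of x alone, so the integral
of the character is at most the L¹ norm of an averaged cocycle. Once `h` is replaced by a coboundary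
this norm tends to 0, by orthogonality of characters or by independence of 1, α, β
(`tendsto_integral_norm_average_cocycle`). Hence Lebesgue measure is the only invariant probability
measure, and minimality follows from its full support.

The self-joining sees the orbit of 0. Starting from (0,0,0) and (β,0,0), the difference z' - z
equals nβ and y equals S_n h(0) + nβ at time n, so y - (z' - z) = S_n h(0). A continuous function
then has divergent averages, which excludes unique ergodicity (`pairCos_iterate`). Evaluation at
these two points carries the argument to the enveloping semigroup. Distality supplies the rest: by
Ellis' theorem the enveloping semigroup is a group, and orbit closures in products of distal flows
are minimal. -/

theorem Homeomorph.pow_apply_eq_iterate (T : X ≃ₜ X) (n : ℕ) (x : X) : (T ^ n) x = T^[n] x := by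
  induction n generalizing x with
  | zero => rfl
  | succ n ih => rw [pow_succ, Homeomorph.mul_apply, ih, Function.iterate_succ_apply]

theorem TopFlow.isUniquelyErgodic_iff [m : MeasurableSpace X] [BorelSpace X] (T : X ≃ₜ X) :
    TopFlow.IsUniquelyErgodic T ↔
      ∃! μ : Measure X, IsProbabilityMeasure μ ∧ μ.Regular ∧ MeasurePreserving T μ μ := by
  have h : m = borel X := BorelSpace.measurable_eq
  subst h
  rfl

variable [CompactSpace X]

theorem abs_birkhoffAverage_le (T : X → X) (f : C(X, ℝ)) (n : ℕ) (x : X) :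
    |birkhoffAverage ℝ T f n x| ≤ ‖f‖ := by
  rcases Nat.eq_zero_or_pos n with rfl | hn
  · simp
  rw [birkhoffAverage, birkhoffSum, smul_eq_mul, abs_mul, abs_inv, Nat.abs_cast,
    inv_mul_le_iff₀ (by positivity)]
  refine (Finset.abs_sum_le_sum_abs _ _).trans ?_
  refine (Finset.sum_le_sum fun i _ => (f.norm_coe_le_norm (T^[i] x))).trans ?_
  simp

/-- Krylov–Bogoliubov: the limit of the Birkhoff averages at a point along an ultrafilter is
integration against an invariant regular Borel probability measure. -/
theorem exists_invariant_measure [T2Space X] [MeasurableSpace X] [BorelSpace X] (T : X ≃ₜ X)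
    (x : X) (U : Ultrafilter ℕ) (hU : (U : Filter ℕ) ≤ atTop) :
    ∃ μ : Measure X, (IsProbabilityMeasure μ ∧ μ.Regular ∧ MeasurePreserving T μ μ) ∧
      ∀ f : C(X, ℝ), Tendsto (fun n => birkhoffAverage ℝ T f n x) U (𝓝 (∫ y, f y ∂μ)) := by
  have hex : ∀ f : C(X, ℝ), ∃ c : ℝ, Tendsto (fun n => birkhoffAverage ℝ T f n x) U (𝓝 c) := by
    intro f
    obtain ⟨c, -, hc⟩ := (isCompact_Icc (a := -‖f‖) (b := ‖f‖)).ultrafilter_le_nhds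
      (U.map fun n => birkhoffAverage ℝ T f n x) (by
        rw [le_principal_iff, Ultrafilter.coe_map, Filter.mem_map]
        exact Filter.univ_mem' fun n => abs_le.1 (abs_birkhoffAverage_le T f _ x))
    exact ⟨c, hc⟩
  choose L hL using hex
  have hLeq : ∀ (f : C(X, ℝ)) (c : ℝ), Tendsto (fun n => birkhoffAverage ℝ T f n x) U (𝓝 c) → L f = c :=
    fun f c h => tendsto_nhds_unique (hL f) h
  let Λ : CompactlySupportedContinuousMap X ℝ →ₚ[ℝ] ℝ :=
    { toFun := fun f => L f
      map_add' := fun f g => hLeq _ _ (by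
        refine ((hL f).add (hL g)).congr fun n => ?_
        simp [birkhoffAverage, birkhoffSum, Finset.sum_add_distrib, mul_add])
      map_smul' := fun a f => hLeq _ _ (by
        refine ((hL f).const_mul a).congr fun n => ?_
        simp only [birkhoffAverage, birkhoffSum, smul_eq_mul, Finset.mul_sum]
        refine Finset.sum_congr rfl fun i _ => ?_
        simp only [ContinuousMap.coe_coe, CompactlySupportedContinuousMap.coe_smul, Pi.smul_apply,
          smul_eq_mul]
        ring)
      monotone' := fun f g hfg => le_of_tendsto_of_tendsto' (hL f) (hL g) fun n => by
        simp only [birkhoffAverage, birkhoffSum, smul_eq_mul]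
        gcongr with i
        exact hfg _ }
  have hint : ∀ f : C(X, ℝ), ∫ y, f y ∂(RealRMK.rieszMeasure Λ) = L f := fun f =>
    RealRMK.integral_rieszMeasure Λ ⟨f, HasCompactSupport.of_compactSpace _⟩
  have hreg : (RealRMK.rieszMeasure Λ).Regular := inferInstance
  have hinv : ∀ f : C(X, ℝ), L (f.comp T) = L f := by
    intro f
    refine hLeq _ _ ?_
    -- The averages at `T x` and at `x` differ only by two boundary terms divided by `n`.
    have h0 : Tendsto (fun n : ℕ => birkhoffAverage ℝ T f n (T x) - birkhoffAverage ℝ T f n x)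
        atTop (𝓝 0) := by
      refine tendsto_birkhoffAverage_apply_sub_birkhoffAverage ℝ ?_
      exact (isCompact_range f.continuous).isBounded.subset (Set.range_subset_iff.2
        fun n => ⟨_, rfl⟩)
    have := (h0.mono_left hU).add (hL f)
    rw [zero_add] at this
    refine this.congr fun n => ?_
    simp [birkhoffAverage, birkhoffSum, ← Function.iterate_succ_apply, Function.iterate_succ_apply']
  refine ⟨RealRMK.rieszMeasure Λ, ⟨⟨?_⟩, hreg, T.continuous.measurable, ?_⟩, fun f => ?_⟩
  · have h1 := hint 1
    have h2 : L 1 = 1 := hLeq _ _ (by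
      refine tendsto_const_nhds.congr' ?_
      filter_upwards [hU (eventually_gt_atTop 0)] with n hn
      simp [birkhoffAverage, birkhoffSum, hn.ne'])
    rw [h2] at h1
    simpa [Measure.real, ENNReal.toReal_eq_one_iff] using h1
  · have : ((RealRMK.rieszMeasure Λ).map T).Regular := Measure.Regular.map T
    refine Measure.ext_of_integral_eq_on_compactlySupported fun f => ?_
    rw [integral_map T.continuous.aemeasurable (f := (f : X → ℝ))
      (map_continuous f).aestronglyMeasurable]
    exact (hint ((f : C(X, ℝ)).comp T)).trans ((hinv f).trans (hint f).symm)
  · rw [hint]; exact hL f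

/-- Along each ultrafilter the averages converge to the integral against some invariant measure,
which can only be `μ`. -/
theorem tendsto_birkhoffAverage_of_unique [T2Space X] [MeasurableSpace X] [BorelSpace X]
    {T : X ≃ₜ X} {μ : Measure X}
    (h : ∀ ν : Measure X, IsProbabilityMeasure ν ∧ ν.Regular ∧ MeasurePreserving T ν ν → ν = μ)
    (f : C(X, ℝ)) (x : X) :
    Tendsto (fun n => birkhoffAverage ℝ T f n x) atTop (𝓝 (∫ y, f y ∂μ)) := by
  rw [tendsto_iff_ultrafilter]
  intro U hU
  obtain ⟨ν, hν, hlim⟩ := exists_invariant_measure T x U hU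
  rw [h ν hν] at hlim
  exact hlim f

theorem TopFlow.IsUniquelyErgodic.exists_tendsto [T2Space X] {T : X ≃ₜ X}
    (h : TopFlow.IsUniquelyErgodic T) (f : C(X, ℝ)) :
    ∃ c, ∀ x, Tendsto (fun n => birkhoffAverage ℝ T f n x) atTop (𝓝 c) := by
  let _ : MeasurableSpace X := borel X
  have : BorelSpace X := ⟨rfl⟩
  obtain ⟨μ, -, hμ⟩ := h
  exact ⟨_, fun x => tendsto_birkhoffAverage_of_unique hμ f x⟩

theorem TopFlow.isUniquelyErgodic_of_unique [T2Space X] [Nonempty X] [MeasurableSpace X]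
    [BorelSpace X] {T : X ≃ₜ X} {μ : Measure X}
    (h : ∀ ν : Measure X, IsProbabilityMeasure ν ∧ ν.Regular ∧ MeasurePreserving T ν ν → ν = μ) :
    TopFlow.IsUniquelyErgodic T := by
  rw [TopFlow.isUniquelyErgodic_iff]
  obtain ⟨ν, hν, -⟩ := exists_invariant_measure T (Classical.arbitrary X)
    (Ultrafilter.of atTop) (Ultrafilter.of_le _)
  exact ⟨ν, hν, fun ν' hν' => (h ν' hν').trans (h ν hν).symm⟩

/-- A Urysohn function vanishing on an orbit closure but not at `y` has zero averages along that
orbit, while its integral is positive because `μ` charges open sets. -/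
theorem TopFlow.isMinimal_of_unique [T2Space X] [MeasurableSpace X]
    [BorelSpace X] {T : X ≃ₜ X} {μ : Measure X} [μ.IsOpenPosMeasure] [IsFiniteMeasure μ]
    (h : ∀ ν : Measure X, IsProbabilityMeasure ν ∧ ν.Regular ∧ MeasurePreserving T ν ν → ν = μ) :
    TopFlow.IsMinimal T := by
  intro x
  rw [dense_iff_closure_eq, Set.eq_univ_iff_forall]
  intro y
  by_contra hy
  obtain ⟨f, hf1, hf0, hf⟩ := exists_continuous_zero_one_of_isClosed
    (isClosed_closure (s := Set.range fun n : ℤ => (T ^ n) x)) (isClosed_singleton (x := y))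
    (Set.disjoint_singleton_right.2 hy)
  have h0 := tendsto_birkhoffAverage_of_unique h f x
  have h1 : ∀ n, birkhoffAverage ℝ T f n x = 0 := by
    intro n
    have : ∀ i, f (T^[i] x) = 0 := fun i => hf1 (subset_closure ⟨(i : ℤ), by
      simp [T.pow_apply_eq_iterate]⟩)
    simp [birkhoffAverage, birkhoffSum, this]
  simp only [h1] at h0
  have h2 := tendsto_nhds_unique h0 tendsto_const_nhds
  have h3 : 0 < ∫ z, f z ∂μ :=
    f.continuous.integral_pos_of_hasCompactSupport_nonneg_nonzero
      (HasCompactSupport.of_compactSpace _) (fun z => (hf z).1) (x := y) (by simp [hf0 rfl])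
  exact h3.ne' h2

end InvariantMeasures

/-! ### Distal flows and enveloping semigroups -/

section Ellis

variable {X Y : Type*} [TopologicalSpace X] [TopologicalSpace Y]

theorem Homeomorph.zpow_semiconj {T : X ≃ₜ X} {R : Y ≃ₜ Y} {π : X → Y}
    (h : ∀ x, π (T x) = R (π x)) (n : ℤ) (x : X) : π ((T ^ n) x) = (R ^ n) (π x) := by
  have hnat : ∀ (n : ℕ) (x : X), π ((T ^ n) x) = (R ^ n) (π x) := by
    intro n
    induction n with
    | zero => intro x; rfl
    | succ n ih => intro x; rw [pow_succ, pow_succ, Homeomorph.mul_apply, Homeomorph.mul_apply, ih, h]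
  obtain ⟨n, rfl | rfl⟩ := n.eq_nat_or_neg
  · simpa using hnat n x
  · apply (R ^ n).injective
    rw [← hnat, ← Homeomorph.mul_apply, ← Homeomorph.mul_apply]
    simp

namespace TopFlow

variable {T : X ≃ₜ X}

theorem zpow_mem_envelopingSemigroup (T : X ≃ₜ X) (n : ℤ) :
    ((T ^ n : X ≃ₜ X) : X → X) ∈ envelopingSemigroup T :=
  subset_closure ⟨n, rfl⟩

/-- Composition is continuous in `p` for fixed `q`, but in `q` only when `p` is continuous. The
closure is therefore taken in two stages, with powers of `T` on the left first. -/
theorem comp_mem_envelopingSemigroup {p q : X → X} (hp : p ∈ envelopingSemigroup T)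
    (hq : q ∈ envelopingSemigroup T) : p ∘ q ∈ envelopingSemigroup T := by
  have h1 : ∀ n : ℤ, ⇑(T ^ n) ∘ q ∈ envelopingSemigroup T := by
    intro n
    refine map_mem_closure (f := fun r : X → X => ⇑(T ^ n) ∘ r)
      (continuous_pi fun x => (T ^ n).continuous.comp (continuous_apply x)) hq ?_
    rintro _ ⟨m, rfl⟩
    exact ⟨n + m, congrArg DFunLike.coe (zpow_add T n m)⟩
  have h2 := map_mem_closure (f := fun r : X → X => r ∘ q)
    (t := envelopingSemigroup T) (continuous_pi fun x => continuous_apply (q x)) hp (by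
      rintro _ ⟨m, rfl⟩
      exact h1 m)
  rwa [envelopingSemigroup, closure_closure] at h2

theorem isCompact_envelopingSemigroup [CompactSpace X] (T : X ≃ₜ X) :
    IsCompact (envelopingSemigroup T) :=
  isClosed_closure.isCompact

/-- Ellis: if all elements of the enveloping semigroup are injective, then it is a group. -/
theorem isCompositionGroup_of_injective [CompactSpace X] [T2Space X]
    (h : ∀ p ∈ envelopingSemigroup T, Function.Injective p) :
    IsCompositionGroup (envelopingSemigroup T) := by
  let _ : Semigroup (X → X) := { mul := (· ∘ ·), mul_assoc := fun _ _ _ => rfl }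
  have hmul : ∀ p q : X → X, p * q = p ∘ q := fun _ _ => rfl
  have hid : id ∈ envelopingSemigroup T := zpow_mem_envelopingSemigroup T 0
  have hcont : ∀ q : X → X, Continuous fun r : X → X => r * q :=
    fun q => continuous_pi fun x => continuous_apply (q x)
  have key : ∀ p ∈ envelopingSemigroup T, ∃ r ∈ envelopingSemigroup T, r ∘ p = id := by
    intro p hp
    -- The left ideal generated by `p` is a compact semigroup, so it contains an idempotent; an
    -- injective idempotent is the identity.
    obtain ⟨_, ⟨r, hr, rfl⟩, hu⟩ := exists_idempotent_in_compact_subsemigroup hcont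
      ((fun r => r * p) '' envelopingSemigroup T) ⟨_, id, hid, rfl⟩
      ((isCompact_envelopingSemigroup T).image (hcont p)) (by
        rintro _ ⟨a, ha, rfl⟩ _ ⟨b, hb, rfl⟩
        exact ⟨a * (p * b), comp_mem_envelopingSemigroup ha (comp_mem_envelopingSemigroup hp hb),
          rfl⟩)
    refine ⟨r, hr, funext fun x => ?_⟩
    exact h _ (comp_mem_envelopingSemigroup hr hp) (congrFun hu x)
  refine ⟨hid, fun p hp q hq => comp_mem_envelopingSemigroup hp hq, fun p hp => ?_⟩
  obtain ⟨r, hr, hrp⟩ := key p hp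
  obtain ⟨s, -, hsr⟩ := key r hr
  have hsp : s = p := by
    calc s = s ∘ (r ∘ p) := by rw [hrp]; rfl
      _ = (s ∘ r) ∘ p := rfl
      _ = p := by rw [hsr]; rfl
  exact ⟨r, hr, hsp ▸ hsr, hrp⟩

theorem coe_orbitFlow_zpow (T : X ≃ₜ X) (x : X) (n : ℤ) (y : orbitClosure T x) :
    (((orbitFlow T x ^ n) y : orbitClosure T x) : X) = (T ^ n) y :=
  Homeomorph.zpow_semiconj (π := ((↑) : orbitClosure T x → X)) (fun _ => rfl) n y

/-- A point of the orbit closure is `p x` for some `p` in the enveloping semigroup, and the inverse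
of `p` leads back to `x`. -/
theorem isMinimal_orbitFlow_of_injective [CompactSpace X] [T2Space X]
    (h : ∀ p ∈ envelopingSemigroup T, Function.Injective p) (x : X) :
    IsMinimal (orbitFlow T x) := by
  intro y
  have hsurj : orbitClosure T x ⊆ (fun p : X → X => p x) '' envelopingSemigroup T := by
    refine closure_minimal ?_
      ((isCompact_envelopingSemigroup T).image (continuous_apply x)).isClosed
    rintro _ ⟨n, rfl⟩
    exact ⟨_, zpow_mem_envelopingSemigroup T n, rfl⟩
  obtain ⟨p, hp, hpx⟩ := hsurj y.2
  obtain ⟨q, hq, -, hqp⟩ := (isCompositionGroup_of_injective h).2.2 p hp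
  have hxy : ∀ n : ℤ, (T ^ n) x ∈ closure (Set.range fun n : ℤ => (T ^ n) (y : X)) := by
    intro n
    have : (T ^ n) x = (⇑(T ^ n) ∘ q) y := by
      rw [← hpx]
      exact congrArg (T ^ n) (congrFun hqp x).symm
    rw [this]
    refine map_mem_closure (f := fun r : X → X => r y) (continuous_apply (y : X))
      (comp_mem_envelopingSemigroup (zpow_mem_envelopingSemigroup T n) hq) ?_
    rintro _ ⟨m, rfl⟩
    exact ⟨m, rfl⟩
  rw [Subtype.dense_iff]
  refine closure_minimal ?_ isClosed_closure
  rintro _ ⟨n, rfl⟩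
  convert hxy n using 2
  rw [← Set.range_comp]
  congr 1
  funext n
  exact coe_orbitFlow_zpow T x n y

/-- The distal lower bound on the distance of two images is a closed condition, so it survives
pointwise limits. -/
theorem IsDistal.injective {Z : Type*} [MetricSpace Z] {T : Z ≃ₜ Z} (h : IsDistal T)
    {p : Z → Z} (hp : p ∈ envelopingSemigroup T) : Function.Injective p := by
  intro x y hxy
  by_contra hne
  have hcl : IsClosed {q : Z → Z | (⨅ n : ℤ, dist ((T ^ n) x) ((T ^ n) y)) ≤ dist (q x) (q y)} :=
    isClosed_le continuous_const ((continuous_apply x).dist (continuous_apply y))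
  have hmem := closure_minimal (s := Set.range fun n : ℤ => ((T ^ n : Z ≃ₜ Z) : Z → Z)) (by
    rintro _ ⟨n, rfl⟩
    exact ciInf_le (f := fun n : ℤ => dist ((T ^ n) x) ((T ^ n) y))
      ⟨0, by rintro _ ⟨n, rfl⟩; exact dist_nonneg⟩ n) hcl hp
  have hpos : 0 < dist (p x) (p y) := (h x y hne).trans_le hmem
  rw [hxy, dist_self] at hpos
  exact hpos.false

theorem isDistal_of_le {Z : Type*} [MetricSpace Z] {T : Z ≃ₜ Z}
    (h : ∀ x y, x ≠ y → ∃ c, 0 < c ∧ ∀ n : ℤ, c ≤ dist ((T ^ n) x) ((T ^ n) y)) : IsDistal T := by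
  intro x y hxy
  obtain ⟨c, hc, hle⟩ := h x y hxy
  exact hc.trans_le (le_ciInf hle)

theorem prodCongr_zpow_apply (T : X ≃ₜ X) (R : Y ≃ₜ Y) (n : ℤ) (w : X × Y) :
    (T.prodCongr R ^ n) w = ((T ^ n) w.1, (R ^ n) w.2) :=
  Prod.ext (Homeomorph.zpow_semiconj (π := Prod.fst) (fun _ => rfl) n w)
    (Homeomorph.zpow_semiconj (π := Prod.snd) (fun _ => rfl) n w)

theorem IsDistal.prodCongr {Z W : Type*} [MetricSpace Z] [MetricSpace W] {T : Z ≃ₜ Z} {R : W ≃ₜ W}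
    (hT : IsDistal T) (hR : IsDistal R) : IsDistal (T.prodCongr R) := by
  refine isDistal_of_le fun x y hxy => ?_
  by_cases h1 : x.1 = y.1
  · have h2 : x.2 ≠ y.2 := fun h2 => hxy (Prod.ext h1 h2)
    refine ⟨_, hR _ _ h2, fun n => ?_⟩
    rw [prodCongr_zpow_apply, prodCongr_zpow_apply]
    exact (ciInf_le ⟨0, by rintro _ ⟨n, rfl⟩; exact dist_nonneg⟩ n).trans (le_max_right _ _)
  · refine ⟨_, hT _ _ h1, fun n => ?_⟩
    rw [prodCongr_zpow_apply, prodCongr_zpow_apply]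
    exact (ciInf_le ⟨0, by rintro _ ⟨n, rfl⟩; exact dist_nonneg⟩ n).trans (le_max_left _ _)

/-- The flow is an isometric extension of a rotation: first coordinates keep their difference, and
points in the same fibre keep theirs. -/
theorem isDistal_torusMap (α : ℝ) (φ : C(UnitAddCircle, UnitAddCircle)) :
    IsDistal (torusMap α φ) := by
  refine isDistal_of_le fun x y hxy => ?_
  have key : ∀ n : ℤ,
      ((torusMap α φ ^ n) x).1 - ((torusMap α φ ^ n) y).1 = x.1 - y.1 ∧
        (x.1 = y.1 → ((torusMap α φ ^ n) x).2 - ((torusMap α φ ^ n) y).2 = x.2 - y.2) := by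
    intro n
    induction n using Int.induction_on with
    | zero => exact ⟨rfl, fun _ => rfl⟩
    | succ n ih =>
      rw [add_comm, zpow_one_add, Homeomorph.mul_apply, Homeomorph.mul_apply]
      generalize (torusMap α φ ^ (n : ℤ)) x = a at *
      generalize (torusMap α φ ^ (n : ℤ)) y = b at *
      refine ⟨?_, fun h => ?_⟩
      · rw [← ih.1]; simp [torusMap]
      · have h1 : a.1 = b.1 := by rw [← sub_eq_zero, ih.1, h, sub_self]
        rw [← ih.2 h]; simp [torusMap, h1, Prod.ext_iff]
    | pred n ih =>
      have hx : ∀ x, (torusMap α φ ^ (-(n : ℤ) - 1)) x =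
          (torusMap α φ).symm ((torusMap α φ ^ (-(n : ℤ))) x) := by
        intro x
        rw [sub_eq_neg_add, zpow_add, Homeomorph.mul_apply, zpow_neg_one]; rfl
      rw [hx, hx]
      generalize (torusMap α φ ^ (-(n : ℤ))) x = a at *
      generalize (torusMap α φ ^ (-(n : ℤ))) y = b at *
      refine ⟨?_, fun h => ?_⟩
      · rw [← ih.1]; simp [torusMap]
      · have h1 : a.1 = b.1 := by rw [← sub_eq_zero, ih.1, h, sub_self]
        rw [← ih.2 h]; simp [torusMap, h1, Prod.ext_iff]
  by_cases h1 : x.1 = y.1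
  · have h2 : x.2 ≠ y.2 := fun h2 => hxy (Prod.ext h1 h2)
    refine ⟨dist x.2 y.2, dist_pos.2 h2, fun n => ?_⟩
    refine le_trans (le_of_eq ?_) (le_max_right _ _)
    have := (key n).2 h1
    rw [dist_eq_norm, dist_eq_norm, this]
  · refine ⟨dist x.1 y.1, dist_pos.2 h1, fun n => ?_⟩
    refine le_trans (le_of_eq ?_) (le_max_left _ _)
    rw [dist_eq_norm, dist_eq_norm, (key n).1]

end TopFlow

end Ellis

/-! ### Characters and measures on tori -/

section Fourier

/-- A finite measure on a compact metric space is determined by the integrals of a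
multiplicative, conjugation invariant, point separating family of continuous functions. -/
theorem measure_ext_of_characters {X ι : Type*} [MetricSpace X] [CompactSpace X]
    [MeasurableSpace X] [BorelSpace X] (χ : ι → C(X, ℂ)) (hone : ∃ k, χ k = 1)
    (hmul : ∀ i j, ∃ k, χ k = χ i * χ j) (hstar : ∀ i, ∃ k, χ k = star (χ i))
    (hsep : ∀ x y, x ≠ y → ∃ i, χ i x ≠ χ i y) {μ ν : Measure X} [IsFiniteMeasure μ]
    [IsFiniteMeasure ν] (h : ∀ i, ∫ x, χ i x ∂μ = ∫ x, χ i x ∂ν) : μ = ν := by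
  let F : ι → BoundedContinuousFunction X ℂ := fun i => BoundedContinuousFunction.mkOfCompact (χ i)
  let A : StarSubalgebra ℂ (BoundedContinuousFunction X ℂ) :=
    { toSubalgebra := Algebra.adjoin ℂ (Set.range F)
      star_mem' := by
        change Algebra.adjoin ℂ (Set.range F) ≤ star (Algebra.adjoin ℂ (Set.range F))
        refine Algebra.adjoin_le ?_
        rintro - ⟨i, rfl⟩
        obtain ⟨k, hk⟩ := hstar i
        refine Algebra.subset_adjoin ⟨k, ?_⟩
        ext x
        exact DFunLike.congr_fun hk x }
  -- The family is closed under products, so the algebra it generates is its linear span, and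
  -- equality of integrals extends by linearity.
  have hspan : Subalgebra.toSubmodule (Algebra.adjoin ℂ (Set.range F)) =
      Submodule.span ℂ (Set.range F) := by
    apply Algebra.adjoin_eq_span_of_subset
    refine Set.Subset.trans ?_ Submodule.subset_span
    intro x hx
    refine Submonoid.closure_induction (fun _ => id) ?_ ?_ hx
    · obtain ⟨k, hk⟩ := hone
      exact ⟨k, by ext x; exact DFunLike.congr_fun hk x⟩
    · rintro - - - - ⟨m, rfl⟩ ⟨n, rfl⟩
      obtain ⟨k, hk⟩ := hmul m n
      exact ⟨k, by ext x; exact DFunLike.congr_fun hk x⟩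
  refine ext_of_forall_mem_subalgebra_integral_eq_of_pseudoEMetric_complete_countable (𝕜 := ℂ)
    (A := A) ?_ ?_
  · intro x y hxy
    obtain ⟨i, hi⟩ := hsep x y hxy
    exact ⟨_, ⟨χ i, ⟨F i, Algebra.subset_adjoin ⟨i, rfl⟩, rfl⟩, rfl⟩, hi⟩
  · intro g hg
    have hg' : g ∈ Submodule.span ℂ (Set.range F) := by
      rw [← hspan]; exact hg
    induction hg' using Submodule.span_induction with
    | mem x hx => obtain ⟨i, rfl⟩ := hx; exact h i
    | zero => simp
    | add x y hx hy ihx ihy =>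
      simp only [BoundedContinuousFunction.coe_add, Pi.add_apply]
      rw [integral_add (x.integrable _) (y.integrable _),
        integral_add (x.integrable _) (y.integrable _),
        ihx (hspan.ge hx), ihy (hspan.ge hy)]
    | smul a x hx ih =>
      simp only [BoundedContinuousFunction.coe_smul]
      rw [integral_smul, integral_smul, ih (hspan.ge hx)]

instance isProbabilityMeasure_volume_unitAddCircle :
    IsProbabilityMeasure (volume : Measure UnitAddCircle) :=
  ⟨UnitAddCircle.measure_univ⟩

instance isProbabilityMeasure_volume_torus : IsProbabilityMeasure
    (volume : Measure (UnitAddCircle × UnitAddCircle × UnitAddCircle)) :=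
  inferInstanceAs (IsProbabilityMeasure ((volume : Measure UnitAddCircle).prod
    ((volume : Measure UnitAddCircle).prod (volume : Measure UnitAddCircle))))

theorem fourier_eq_one_iff {n : ℤ} {a : UnitAddCircle} : fourier n a = 1 ↔ n • a = 0 := by
  rw [fourier_apply, Circle.coe_eq_one, ← AddCircle.toCircle_zero (T := (1 : ℝ))]
  exact (AddCircle.injective_toCircle one_ne_zero).eq_iff

theorem norm_fourier_apply (n : ℤ) (x : UnitAddCircle) : ‖fourier n x‖ = 1 :=
  Circle.norm_coe _

theorem fourier_apply_add (n : ℤ) (x y : UnitAddCircle) :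
    fourier n (x + y) = fourier n x * fourier n y := by
  simp only [fourier_apply, smul_add, AddCircle.toCircle_add, Circle.coe_mul]

theorem integral_fourier {n : ℤ} (hn : n ≠ 0) : ∫ x : UnitAddCircle, fourier n x = 0 :=
  integral_eq_zero_of_add_right_eq_neg (μ := volume) (fourier_add_half_inv_index hn one_pos)

theorem fourier_separates {x y : UnitAddCircle} (h : x ≠ y) : fourier 1 x ≠ fourier 1 y := by
  rw [fourier_one, fourier_one, Ne, Circle.coe_inj]
  exact fun h' => h (AddCircle.injective_toCircle one_ne_zero h')

/-- Rotation invariance multiplies the integral by e(nα), which is not 1. -/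
theorem integral_fourier_eq_zero {α : UnitAddCircle} (hα : ∀ n : ℤ, n • α = 0 → n = 0)
    {μ : Measure UnitAddCircle} (h : MeasurePreserving (· + α) μ μ) {n : ℤ} (hn : n ≠ 0) :
    ∫ x, fourier n x ∂μ = 0 := by
  have h1 : ∫ x, fourier n x ∂μ = ∫ x, fourier n (x + α) ∂μ :=
    (h.integral_comp (Homeomorph.addRight α).measurableEmbedding _).symm
  simp_rw [fourier_apply_add, integral_mul_const] at h1
  have h2 : fourier n α ≠ 1 := fun h' => hn (hα n (fourier_eq_one_iff.1 h'))
  have h3 : (∫ x, fourier n x ∂μ) * (fourier n α - 1) = 0 := by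
    rw [mul_sub, ← h1, mul_one, sub_self]
  exact (mul_eq_zero.1 h3).resolve_right (sub_ne_zero.2 h2)

theorem eq_volume_of_rotation_invariant {α : UnitAddCircle} (hα : ∀ n : ℤ, n • α = 0 → n = 0)
    {μ : Measure UnitAddCircle} [IsProbabilityMeasure μ] (h : MeasurePreserving (· + α) μ μ) :
    μ = volume := by
  refine measure_ext_of_characters (fun n : ℤ => fourier n) ⟨0, ?_⟩
    (fun i j => ⟨i + j, ?_⟩) (fun i => ⟨-i, ?_⟩) (fun x y hxy => ⟨1, fourier_separates hxy⟩)
    fun n => ?_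
  · ext x; exact fourier_zero
  · ext x; exact fourier_add
  · ext x; exact fourier_neg
  · by_cases hn : n = 0
    · subst hn; simp
    · rw [integral_fourier hn, integral_fourier_eq_zero hα h hn]

/-- The character `(x, y, z) ↦ e(jx + ky + mz)` of the torus. -/
noncomputable def torusChar (i : ℤ × ℤ × ℤ) :
    C(UnitAddCircle × UnitAddCircle × UnitAddCircle, ℂ) where
  toFun w := fourier i.1 w.1 * (fourier i.2.1 w.2.1 * fourier i.2.2 w.2.2)
  continuous_toFun := by fun_prop

theorem eq_volume_of_integral_torusChar
    {μ : Measure (UnitAddCircle × UnitAddCircle × UnitAddCircle)} [IsProbabilityMeasure μ]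
    (h : ∀ i, i ≠ 0 → ∫ w, torusChar i w ∂μ = 0) : μ = volume := by
  refine measure_ext_of_characters torusChar ⟨0, ?_⟩
    (fun i j => ⟨i + j, ?_⟩) (fun i => ⟨-i, ?_⟩) (fun x y hxy => ?_) fun i => ?_
  · ext w
    change fourier 0 w.1 * (fourier 0 w.2.1 * fourier 0 w.2.2) = 1
    simp only [fourier_zero, mul_one]
  · ext w
    change fourier (i.1 + j.1) w.1 * (fourier (i.2.1 + j.2.1) w.2.1 * fourier (i.2.2 + j.2.2) w.2.2)
      = fourier i.1 w.1 * (fourier i.2.1 w.2.1 * fourier i.2.2 w.2.2) *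
        (fourier j.1 w.1 * (fourier j.2.1 w.2.1 * fourier j.2.2 w.2.2))
    simp only [fourier_add]
    ring
  · ext w
    change fourier (-i.1) w.1 * (fourier (-i.2.1) w.2.1 * fourier (-i.2.2) w.2.2) =
      (starRingEnd ℂ) (fourier i.1 w.1 * (fourier i.2.1 w.2.1 * fourier i.2.2 w.2.2))
    simp only [fourier_neg, map_mul]
  · by_cases h1 : x.1 = y.1
    · by_cases h2 : x.2.1 = y.2.1
      · have h3 : x.2.2 ≠ y.2.2 := fun h3 => hxy (Prod.ext h1 (Prod.ext h2 h3))
        refine ⟨(0, 0, 1), ?_⟩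
        change fourier 0 x.1 * (fourier 0 x.2.1 * fourier 1 x.2.2) ≠
          fourier 0 y.1 * (fourier 0 y.2.1 * fourier 1 y.2.2)
        simpa only [fourier_zero, one_mul] using fourier_separates h3
      · refine ⟨(0, 1, 0), ?_⟩
        change fourier 0 x.1 * (fourier 1 x.2.1 * fourier 0 x.2.2) ≠
          fourier 0 y.1 * (fourier 1 y.2.1 * fourier 0 y.2.2)
        simpa only [fourier_zero, one_mul, mul_one] using fourier_separates h2
    · refine ⟨(1, 0, 0), ?_⟩
      change fourier 1 x.1 * (fourier 0 x.2.1 * fourier 0 x.2.2) ≠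
        fourier 1 y.1 * (fourier 0 y.2.1 * fourier 0 y.2.2)
      simpa only [fourier_zero, one_mul, mul_one] using fourier_separates h1
  · by_cases hi : i = 0
    · subst hi
      have : ∀ w, torusChar 0 w = 1 := fun w => by
        change fourier 0 w.1 * (fourier 0 w.2.1 * fourier 0 w.2.2) = 1
        simp only [fourier_zero, mul_one]
      simp [this]
    · rw [h i hi]
      change 0 = ∫ w : UnitAddCircle × UnitAddCircle × UnitAddCircle,
        fourier i.1 w.1 * (fourier i.2.1 w.2.1 * fourier i.2.2 w.2.2)
      rw [Measure.volume_eq_prod, integral_prod_mul (fun x => fourier i.1 x)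
        (fun v : UnitAddCircle × UnitAddCircle => fourier i.2.1 v.1 * fourier i.2.2 v.2),
        Measure.volume_eq_prod, integral_prod_mul (fun x => fourier i.2.1 x)
        (fun x => fourier i.2.2 x)]
      by_cases h1 : i.1 = 0
      · by_cases h2 : i.2.1 = 0
        · have h3 : i.2.2 ≠ 0 := fun h3 => hi (Prod.ext h1 (Prod.ext h2 h3))
          rw [integral_fourier h3, mul_zero, mul_zero]
        · rw [integral_fourier h2, zero_mul, mul_zero]
      · rw [integral_fourier h1, zero_mul]

end Fourier

/-! ### Limits of coboundaries with oscillating ergodic sums -/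

section CoboundaryLimit

theorem exists_nsmul_norm_le (α : UnitAddCircle) {δ : ℝ} (hδ : 0 < δ) :
    ∃ q : ℕ, 0 < q ∧ ‖q • α‖ ≤ δ := by
  induction α using QuotientAddGroup.induction_on with
  | H a =>
    obtain ⟨n, hn⟩ := exists_nat_one_div_lt hδ
    obtain ⟨k, hk, -, hk'⟩ := Real.exists_nat_abs_mul_sub_round_le a n.succ_pos
    refine ⟨k, hk, ?_⟩
    change ‖k • ((a : ℝ) : UnitAddCircle)‖ ≤ δ
    rw [← AddCircle.coe_nsmul, UnitAddCircle.norm_eq, nsmul_eq_mul]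
    refine hk'.trans (le_trans ?_ hn.le)
    push_cast
    gcongr
    linarith

/-- There are continuous functions of small integral and large value at `0` which are almost
invariant under a given rotation. -/
theorem exists_almost_invariant (α : UnitAddCircle) {ε : ℝ} (hε : 0 < ε) :
    ∃ g : C(UnitAddCircle, ℝ), g 0 = 1 / 2 ∧ (∀ x, |g (x + α) - g x| ≤ ε) ∧
      ∫ x, |g x| ≤ ε := by
  obtain ⟨q, hq, hqα⟩ := exists_nsmul_norm_le α (mul_pos hε hε)
  -- A tent of height 1/2, slope 1/ε and radius ε/2. The function x ↦ b(qx) moves under rotation by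
  -- α by at most ‖qα‖/ε ≤ ε, which is why `q` was chosen for ε².
  let b : UnitAddCircle → ℝ := fun x => max 0 (1 / 2 - ε⁻¹ * ‖x‖)
  have hb : Continuous b := by fun_prop
  have hb0 : ∀ x, 0 ≤ b x := fun x => le_max_left _ _
  refine ⟨⟨fun x => b (q • x), hb.comp (continuous_nsmul q)⟩, by simp [b], fun x => ?_, ?_⟩
  · change |b (q • (x + α)) - b (q • x)| ≤ ε
    refine (abs_max_sub_max_le_max _ _ _ _).trans ?_
    rw [sub_self, abs_zero, max_eq_right (abs_nonneg _), sub_sub_sub_cancel_left, ← mul_sub,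
      abs_mul, abs_of_pos (inv_pos.2 hε), inv_mul_le_iff₀ hε]
    refine (abs_norm_sub_norm_le _ _).trans ?_
    rwa [smul_add, ← norm_neg, neg_sub, add_sub_cancel_left]
  · change ∫ x : UnitAddCircle, |b (q • x)| ≤ ε
    have hmp : MeasurePreserving (fun x : UnitAddCircle => q • x) volume volume := by
      simpa using Measure.measurePreserving_zsmul (volume : Measure UnitAddCircle)
        (n := (q : ℤ)) (by exact_mod_cast hq.ne')
    have h1 : ∫ x : UnitAddCircle, |b (q • x)| = ∫ x, |b x| := by
      have := hmp.map_eq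
      conv_rhs => rw [← this]
      rw [integral_map hmp.measurable.aemeasurable hb.abs.aestronglyMeasurable]
    rw [h1]
    have h2 : ∀ x, |b x| ≤ (Metric.closedBall (0 : UnitAddCircle) (ε / 2)).indicator
        (fun _ => (1 / 2 : ℝ)) x := by
      intro x
      rw [abs_of_nonneg (hb0 x)]
      by_cases hx : x ∈ Metric.closedBall (0 : UnitAddCircle) (ε / 2)
      · rw [Set.indicator_of_mem hx]
        refine max_le (by norm_num) (sub_le_self _ (by positivity))
      · rw [Set.indicator_of_notMem hx]
        refine max_le le_rfl ?_
        rw [mem_closedBall_zero_iff, not_le] at hx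
        rw [sub_nonpos, le_inv_mul_iff₀ hε]
        linarith
    have hm : MeasurableSet (Metric.closedBall (0 : UnitAddCircle) (ε / 2)) :=
      Metric.isClosed_closedBall.measurableSet
    refine (integral_mono (hb.abs.integrable_of_hasCompactSupport
      (HasCompactSupport.of_compactSpace _)) ((integrable_const _).indicator hm) h2).trans ?_
    rw [integral_indicator_const _ hm, Measure.real, AddCircle.volume_closedBall, smul_eq_mul]
    have : (ENNReal.ofReal (min 1 (2 * (ε / 2)))).toReal ≤ ε := by
      rw [ENNReal.toReal_ofReal (by positivity)]
      exact (min_le_right _ _).trans (by linarith)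
    linarith

/-- Continuous functions on the circle are integrable. -/
theorem ContinuousMap.integrable_unitAddCircle {E : Type*} [NormedAddCommGroup E]
    {f : UnitAddCircle → E} (hf : Continuous f) : Integrable f :=
  hf.integrable_of_hasCompactSupport (HasCompactSupport.of_compactSpace _)

theorem tendsto_average_rotation {α : UnitAddCircle} (hα : ∀ n : ℤ, n • α = 0 → n = 0)
    (f : C(UnitAddCircle, ℝ)) :
    Tendsto (fun N : ℕ => (N : ℝ)⁻¹ * ∑ n ∈ Finset.range N, f (n • α)) atTop (𝓝 (∫ x, f x)) := by
  have h := tendsto_birkhoffAverage_of_unique (T := Homeomorph.addRight α) (μ := volume)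
    (fun ν hν => by
      have := hν.1
      exact eq_volume_of_rotation_invariant hα hν.2.2) f 0
  have hit : ∀ n : ℕ, (Homeomorph.addRight α)^[n] 0 = n • α := by
    intro n
    induction n with
    | zero => simp
    | succ n ih => rw [Function.iterate_succ_apply', ih, succ_nsmul]; rfl
  simpa only [birkhoffAverage, birkhoffSum, hit, smul_eq_mul] using h

theorem abs_cos_sub_cos_le (a b : ℝ) : |Real.cos a - Real.cos b| ≤ |a - b| := by
  have h := Real.lipschitzWith_cos.dist_le_mul a b
  simpa [Real.dist_eq] using h

theorem one_sub_le_integral_cos (G : C(UnitAddCircle, ℝ)) :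
    1 - 2 * Real.pi * ∫ x, |G x| ≤ ∫ x, Real.cos (2 * Real.pi * G x) := by
  have h1 : ∀ x, 1 - 2 * Real.pi * |G x| ≤ Real.cos (2 * Real.pi * G x) := by
    intro x
    have := abs_le.1 (abs_cos_sub_cos_le (2 * Real.pi * G x) 0)
    rw [Real.cos_zero, sub_zero, abs_mul, abs_of_pos Real.two_pi_pos] at this
    linarith [this.1]
  have h2 := integral_mono (μ := (volume : Measure UnitAddCircle))
    (ContinuousMap.integrable_unitAddCircle (by fun_prop))
    (ContinuousMap.integrable_unitAddCircle (by fun_prop)) h1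
  rwa [integral_sub (integrable_const _) (ContinuousMap.integrable_unitAddCircle (by fun_prop)),
    integral_const_mul, integral_const, probReal_univ, one_smul] at h2

/-- One step in the construction of a limit of coboundaries. -/
theorem exists_coboundary_step {α : UnitAddCircle} (hα : ∀ n : ℤ, n • α = 0 → n = 0) {η : ℝ}
    (hη : 0 < η) (k : ℕ) (s : C(UnitAddCircle, ℝ) × ℕ) :
    ∃ s' : C(UnitAddCircle, ℝ) × ℕ, s'.1 0 = s.1 0 + 1 / 2 ∧
      (∀ x, |(s.1 (x + α) - s.1 x) - (s'.1 (x + α) - s'.1 x)| ≤ η / (s.2 + 1) / 2 / 2 ^ k) ∧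
      ∫ x, |s'.1 x - s.1 x| ≤ η / 2 / 2 ^ k ∧ s.2 < s'.2 ∧
      |(s'.2 : ℝ)⁻¹ * ∑ n ∈ Finset.range s'.2, Real.cos (2 * Real.pi * s'.1 (n • α)) -
        ∫ x, Real.cos (2 * Real.pi * s'.1 x)| ≤ 1 / 16 := by
  -- Division by `s.2 + 1` keeps the error below η after summation over `s.2` steps; the factor
  -- 1/2/2^k makes the errors of all stages summable.
  obtain ⟨g, hg0, hg, hgi⟩ := exists_almost_invariant α
    (ε := η / (s.2 + 1) / 2 / 2 ^ k) (by positivity)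
  have h := tendsto_average_rotation hα
    ⟨fun x => Real.cos (2 * Real.pi * (s.1 + g) x), by fun_prop⟩
  obtain ⟨N, hN⟩ := Metric.tendsto_atTop'.1 h (1 / 16) (by norm_num)
  refine ⟨(s.1 + g, N + s.2 + 1), ?_, fun x => ?_, ?_, by dsimp only; omega,
    (hN (N + s.2 + 1) (by omega)).le⟩
  · simp [hg0]
  · rw [abs_sub_comm]
    convert hg x using 2
    simp only [ContinuousMap.add_apply]
    ring
  · simp only [ContinuousMap.add_apply, add_sub_cancel_left]
    refine hgi.trans ?_
    gcongr
    exact div_le_self hη.le (by linarith [(Nat.cast_nonneg s.2 : (0 : ℝ) ≤ s.2)])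

/-- The averages of `cos (2π S_n h(0))`, where `S_n h` is the `n`-th ergodic sum of `h`. -/
noncomputable def cosAverage (α : UnitAddCircle) (h : UnitAddCircle → ℝ) (N : ℕ) : ℝ :=
  (N : ℝ)⁻¹ * ∑ n ∈ Finset.range N,
    Real.cos (2 * Real.pi * ∑ i ∈ Finset.range n, h (i • α))

/-- The ergodic sums of a coboundary telescope, so only the error `δ` accumulates. -/
theorem abs_sum_le_of_abs_sub_coboundary_le {α : UnitAddCircle} {h G : UnitAddCircle → ℝ} {δ : ℝ}
    (hδ : ∀ x, |h x - (G (x + α) - G x)| ≤ δ) (n : ℕ) (x : UnitAddCircle) :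
    |∑ i ∈ Finset.range n, h (x + i • α) - (G (x + n • α) - G x)| ≤ n * δ := by
  have h1 : G (x + n • α) - G x =
      ∑ i ∈ Finset.range n, (G (x + i • α + α) - G (x + i • α)) := by
    have := Finset.sum_range_sub (fun i => G (x + i • α)) n
    simpa only [succ_nsmul, ← add_assoc, zero_smul, add_zero] using this.symm
  rw [h1, ← Finset.sum_sub_distrib]
  refine (Finset.abs_sum_le_sum_abs _ _).trans ((Finset.sum_le_sum fun i _ => hδ _).trans ?_)
  simp

theorem abs_average_sub_average_le {a b : ℕ → ℝ} {c : ℝ} (hc : 0 ≤ c) {N : ℕ}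
    (h : ∀ n < N, |a n - b n| ≤ c) :
    |(N : ℝ)⁻¹ * ∑ n ∈ Finset.range N, a n - (N : ℝ)⁻¹ * ∑ n ∈ Finset.range N, b n| ≤ c := by
  rcases Nat.eq_zero_or_pos N with rfl | hN
  · simpa using hc
  rw [← mul_sub, ← Finset.sum_sub_distrib, abs_mul, abs_inv, Nat.abs_cast,
    inv_mul_le_iff₀ (by positivity)]
  refine (Finset.abs_sum_le_sum_abs _ _).trans
    ((Finset.sum_le_sum fun n hn => h n (Finset.mem_range.1 hn)).trans ?_)
  simp

/-- There is a continuous function which is a limit of coboundaries, uniformly, whose transfer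
functions converge in mean, but for which the averages of `e(S_n h(0))` diverge. -/
theorem exists_limit_of_coboundaries {α : UnitAddCircle} (hα : ∀ n : ℤ, n • α = 0 → n = 0) :
    ∃ h : C(UnitAddCircle, ℝ),
      (∀ ε > 0, ∃ G : C(UnitAddCircle, ℝ), ∀ δ > 0, ∃ G' : C(UnitAddCircle, ℝ),
        ∫ x, |G' x - G x| ≤ ε ∧ ∀ x, |h x - (G' (x + α) - G' x)| ≤ δ) ∧
      (∀ M, ∃ N ≥ M, 1 / 2 ≤ cosAverage α h N) ∧
      ∀ M, ∃ N ≥ M, cosAverage α h N ≤ -(1 / 2) := by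
  -- The averages lose 1/16 to equidistribution, 2π/32 to the mean of |G_k| and 2π/32 to replacing
  -- `h` by a coboundary, in all less than 1/2.
  have hη : (0 : ℝ) < 1 / 32 := by norm_num
  choose F hF0 hFα hFi hFlt hFavg using exists_coboundary_step hα hη
  let s : ℕ → C(UnitAddCircle, ℝ) × ℕ := fun k => Nat.rec (0, 0) F k
  have hs : ∀ k, s (k + 1) = F k (s k) := fun k => rfl
  let D : ℕ → C(UnitAddCircle, ℝ) := fun k => (s k).1.comp (Homeomorph.addRight α) - (s k).1
  have hD : ∀ k x, D k x = (s k).1 (x + α) - (s k).1 x := fun k x => rfl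
  have hM : Monotone fun k => (s k).2 := monotone_nat_of_le_succ fun k => (hFlt k (s k)).le
  have hkM : ∀ k, k ≤ (s k).2 := by
    intro k
    induction k with
    | zero => exact Nat.zero_le _
    | succ k ih => exact Nat.succ_le_of_lt (ih.trans_lt (hFlt k (s k)))
  have hdist : ∀ k, dist (D k) (D (k + 1)) ≤ 1 / 32 / ((s k).2 + 1) / 2 / 2 ^ k := fun k =>
    (ContinuousMap.dist_le (by positivity)).2 fun x => hFα k (s k) x
  -- Since the lengths increase, all stages after `k` are controlled by the length `(s k).2`; the
  -- limit `h` is then close enough for sums of that length.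
  have hdist' : ∀ k j, dist (D (k + j)) (D (k + (j + 1))) ≤
      1 / 32 / 2 ^ k / ((s k).2 + 1) / 2 / 2 ^ j := by
    intro k j
    refine (hdist (k + j)).trans ?_
    have h1 : ((s k).2 : ℝ) ≤ (s (k + j)).2 := by exact_mod_cast hM (Nat.le_add_right k j)
    calc _ ≤ (1 : ℝ) / 32 / ((s k).2 + 1) / 2 / 2 ^ (k + j) := by gcongr
      _ = _ := by rw [pow_add]; field_simp
  have hcau : CauchySeq D := cauchySeq_of_le_geometric_two (C := 1 / 32 / 2 ^ 0 / ((s 0).2 + 1))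
    (fun j => by simpa using hdist' 0 j)
  obtain ⟨h, hh⟩ := cauchySeq_tendsto_of_complete hcau
  have hlim : ∀ k, dist (D k) h ≤ 1 / 32 / 2 ^ k / ((s k).2 + 1) := fun k =>
    dist_le_of_le_geometric_two_of_tendsto₀ (f := fun j => D (k + j)) (hdist' k)
      (hh.comp (tendsto_add_atTop_nat k |>.congr fun j => add_comm _ _))
  have happrox : ∀ k x, |h x - ((s k).1 (x + α) - (s k).1 x)| ≤
      1 / 32 / 2 ^ k / ((s k).2 + 1) := by
    intro k x
    have := (ContinuousMap.dist_apply_le_dist x).trans (hlim k)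
    rwa [dist_comm, Real.dist_eq, hD] at this
  have hzero : ∀ k, (s k).1 0 = k / 2 := by
    intro k
    induction k with
    | zero => simp [s]
    | succ k ih => rw [hs, hF0, ih]; push_cast; ring
  -- The factor `1 - 1 / 2 ^ j` is the partial geometric sum, kept so that the induction closes.
  have hint : ∀ k j, ∫ x, |(s (k + j)).1 x - (s k).1 x| ≤ 1 / 32 / 2 ^ k * (1 - 1 / 2 ^ j) := by
    intro k j
    induction j with
    | zero => simp
    | succ j ih =>
      have h1 := hFi (k + j) (s (k + j))
      rw [← hs] at h1
      have h2 : ∫ x, |(s (k + (j + 1))).1 x - (s k).1 x| ≤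
          ∫ x, (|(s (k + j + 1)).1 x - (s (k + j)).1 x| + |(s (k + j)).1 x - (s k).1 x|) :=
        integral_mono (ContinuousMap.integrable_unitAddCircle (by fun_prop))
          (ContinuousMap.integrable_unitAddCircle (by fun_prop)) fun x => abs_sub_le _ _ _
      rw [integral_add (ContinuousMap.integrable_unitAddCircle (by fun_prop))
        (ContinuousMap.integrable_unitAddCircle (by fun_prop))] at h2
      refine h2.trans ((add_le_add h1 ih).trans (le_of_eq ?_))
      rw [pow_add, pow_succ]
      field_simp
      ring
  have hint' : ∀ k j, ∫ x, |(s (k + j)).1 x - (s k).1 x| ≤ 1 / 32 / 2 ^ k := fun k j =>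
    (hint k j).trans (mul_le_of_le_one_right (by positivity) (sub_le_self _ (by positivity)))
  -- As G_{k+1}(0) = (k+1)/2, subtracting it inside the cosine only produces the sign cos(π(k+1)).
  have hcos : ∀ k, |cosAverage α h (s (k + 1)).2 - Real.cos (Real.pi * (k + 1)) *
      ((s (k + 1)).2 : ℝ)⁻¹ * ∑ n ∈ Finset.range (s (k + 1)).2,
        Real.cos (2 * Real.pi * (s (k + 1)).1 (n • α))| ≤ 2 * Real.pi * (1 / 32) := by
    intro k
    have hsin : Real.sin (Real.pi * (k + 1)) = 0 := by
      rw [mul_comm]; exact_mod_cast Real.sin_nat_mul_pi (k + 1)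
    have h0 : ∀ n : ℕ, Real.cos (Real.pi * (k + 1)) *
        Real.cos (2 * Real.pi * (s (k + 1)).1 (n • α)) =
        Real.cos (2 * Real.pi * ((s (k + 1)).1 (n • α) - (s (k + 1)).1 0)) := by
      intro n
      rw [mul_sub, Real.cos_sub, show (s (k + 1)).1 0 = _ from hzero (k + 1)]
      have : 2 * Real.pi * (((k + 1 : ℕ) : ℝ) / 2) = Real.pi * (k + 1) := by push_cast; ring
      rw [this, hsin]
      ring
    rw [mul_assoc, mul_left_comm, Finset.mul_sum]
    refine abs_average_sub_average_le (by positivity) fun n hn => ?_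
    rw [h0]
    refine (abs_cos_sub_cos_le _ _).trans ?_
    rw [← mul_sub, abs_mul, abs_of_pos Real.two_pi_pos]
    refine mul_le_mul_of_nonneg_left ?_ Real.two_pi_pos.le
    have h1 := abs_sum_le_of_abs_sub_coboundary_le (happrox (k + 1)) n 0
    simp only [zero_add] at h1
    refine h1.trans ?_
    have h2 : (n : ℝ) ≤ (s (k + 1)).2 + 1 := by
      have : (n : ℝ) ≤ (s (k + 1)).2 := by exact_mod_cast hn.le
      linarith
    rw [mul_div_assoc', div_le_iff₀ (by positivity), mul_comm]
    refine mul_le_mul ?_ h2 (by positivity) (by norm_num)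
    exact div_le_self (by norm_num) (one_le_pow₀ (by norm_num))
  have hlow : ∀ k, 15 / 16 - 2 * Real.pi * (1 / 32) ≤ ((s (k + 1)).2 : ℝ)⁻¹ *
      ∑ n ∈ Finset.range (s (k + 1)).2, Real.cos (2 * Real.pi * (s (k + 1)).1 (n • α)) := by
    intro k
    have h1 := (abs_le.1 (hFavg k (s k))).1
    rw [← hs] at h1
    have h2 := one_sub_le_integral_cos (s (k + 1)).1
    have h3 := hint' 0 (k + 1)
    have h4 : ∫ x, |(s (k + 1)).1 x| ≤ 1 / 32 := by
      simpa [s] using h3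
    have h5 := mul_le_mul_of_nonneg_left h4 Real.two_pi_pos.le
    linarith
  have hpi := Real.pi_lt_d2
  refine ⟨h, fun ε hε => ?_, fun M => ?_, fun M => ?_⟩
  · have hpow : ∀ δ : ℝ, 0 < δ → ∃ k : ℕ, ∀ j ≥ k, 1 / 32 / 2 ^ j ≤ δ := by
      intro δ hδ
      obtain ⟨k, hk⟩ := exists_pow_lt_of_lt_one hδ (by norm_num : (1 / 2 : ℝ) < 1)
      refine ⟨k, fun j hj => ?_⟩
      have h1 : (1 / 2 : ℝ) ^ j ≤ (1 / 2) ^ k := pow_le_pow_of_le_one (by norm_num) (by norm_num) hj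
      have h2 : (1 : ℝ) / 32 / 2 ^ j = 1 / 32 * (1 / 2) ^ j := by
        rw [one_div_pow]; ring
      have h3 : (0 : ℝ) ≤ (1 / 2) ^ j := by positivity
      rw [h2]
      linarith
    obtain ⟨J, hJ⟩ := hpow ε hε
    -- The stage `J` depends on ε alone; a later stage approximates `h` to within δ and is still
    -- ε-close to stage `J` in mean.
    refine ⟨(s J).1, fun δ hδ => ?_⟩
    obtain ⟨K, hK⟩ := hpow δ hδ
    refine ⟨(s (J + K)).1, (hint' J K).trans (hJ J le_rfl), fun x => ?_⟩
    refine (happrox (J + K) x).trans ((div_le_self (by positivity) ?_).trans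
      (hK _ (Nat.le_add_left K J)))
    linarith [(Nat.cast_nonneg (s (J + K)).2 : (0 : ℝ) ≤ _)]
  -- Even stages give the sign +1; the odd stages used below give -1.
  · refine ⟨(s (2 * M + 1 + 1)).2, ?_, ?_⟩
    · have := hkM (2 * M + 1 + 1); omega
    · have h1 := abs_le.1 (hcos (2 * M + 1))
      have h2 := hlow (2 * M + 1)
      have h3 : Real.cos (Real.pi * (((2 * M + 1 : ℕ) : ℝ) + 1)) = 1 := by
        refine Eq.trans (congrArg Real.cos ?_) (Real.cos_nat_mul_two_pi (M + 1))
        push_cast; ring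
      rw [h3, one_mul] at h1
      linarith [h1.1]
  · refine ⟨(s (2 * M + 1)).2, ?_, ?_⟩
    · have := hkM (2 * M + 1); omega
    · have h1 := abs_le.1 (hcos (2 * M))
      have h2 := hlow (2 * M)
      have h3 : Real.cos (Real.pi * (((2 * M : ℕ) : ℝ) + 1)) = -1 := by
        rw [← Real.cos_nat_mul_two_pi_add_pi M]
        congr 1; push_cast; ring
      rw [h3, neg_one_mul, neg_mul] at h1
      linarith [h1.2]

end CoboundaryLimit

/-! ### Mean decay of averaged cocycles -/

section ErgodicSums

/-- The multiplicative cocycle `∏_{i < d} c e(m(x + iα))`. -/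
noncomputable def charCocycle (α : UnitAddCircle) (c : ℂ) (m : ℤ) (d : ℕ) (x : UnitAddCircle) : ℂ :=
  ∏ i ∈ Finset.range d, (c * fourier m (x + i • α))

@[fun_prop]
theorem continuous_charCocycle (α : UnitAddCircle) (c : ℂ) (m : ℤ) (d : ℕ) :
    Continuous (charCocycle α c m d) := by
  unfold charCocycle
  fun_prop

theorem norm_charCocycle {α : UnitAddCircle} {c : ℂ} (hc : ‖c‖ = 1) (m : ℤ) (d : ℕ)
    (x : UnitAddCircle) : ‖charCocycle α c m d x‖ = 1 := by
  rw [charCocycle, norm_prod]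
  exact Finset.prod_eq_one fun i _ => by rw [norm_mul, hc, norm_fourier_apply, one_mul]

/-- In `x` the cocycle is a single character of frequency `m * d`; for `m ≠ 0` different `d` are
therefore orthogonal. -/
theorem charCocycle_eq (α : UnitAddCircle) (c : ℂ) (m : ℤ) (d : ℕ) (x : UnitAddCircle) :
    charCocycle α c m d x = charCocycle α c m d 0 * fourier (m * d) x := by
  have h : fourier (m * d) x = ∏ i ∈ Finset.range d, fourier m x := by
    rw [Finset.prod_const, Finset.card_range]
    induction d with
    | zero => simp
    | succ d ih => rw [pow_succ, ← ih, ← fourier_add]; congr 2; push_cast; ring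
  rw [h, charCocycle, charCocycle, ← Finset.prod_mul_distrib]
  refine Finset.prod_congr rfl fun i _ => ?_
  rw [fourier_apply_add, zero_add]
  ring

/-- The `L¹` norm of the averages of `f(x + dα) ∏_{i < d} c e(m(x + iα))`. -/
noncomputable def twistedAverageNorm (α : UnitAddCircle) (c : ℂ) (m : ℤ)
    (f : UnitAddCircle → ℂ) (D : ℕ) : ℝ :=
  ∫ x, ‖(D : ℂ)⁻¹ * ∑ d ∈ Finset.range D, f (x + d • α) * charCocycle α c m d x‖

theorem norm_average_le {a : ℕ → ℂ} {c : ℝ} (hc : 0 ≤ c) {N : ℕ} (h : ∀ n < N, ‖a n‖ ≤ c) :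
    ‖(N : ℂ)⁻¹ * ∑ n ∈ Finset.range N, a n‖ ≤ c := by
  rcases Nat.eq_zero_or_pos N with rfl | hN
  · simpa using hc
  rw [norm_mul, norm_inv, Complex.norm_natCast, inv_mul_le_iff₀ (by positivity)]
  refine (norm_sum_le _ _).trans
    ((Finset.sum_le_sum fun n hn => h n (Finset.mem_range.1 hn)).trans ?_)
  simp

theorem integral_norm_sq_trigonometric_sum {m : ℤ} (hm : m ≠ 0) {a : ℕ → ℂ} (ha : ∀ d, ‖a d‖ = 1)
    (D : ℕ) : ∫ x : UnitAddCircle, ‖∑ d ∈ Finset.range D, a d * fourier (m * d) x‖ ^ 2 = D := by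
  have h1 : ∀ x : UnitAddCircle, ((‖∑ d ∈ Finset.range D, a d * fourier (m * d) x‖ ^ 2 : ℝ) : ℂ) =
      ∑ d ∈ Finset.range D, ∑ d' ∈ Finset.range D,
        (a d * (starRingEnd ℂ) (a d')) * fourier (m * d + -(m * d')) x := by
    intro x
    rw [Complex.ofReal_pow, ← Complex.mul_conj', map_sum, Finset.sum_mul_sum]
    refine Finset.sum_congr rfl fun d _ => Finset.sum_congr rfl fun d' _ => ?_
    rw [fourier_add, fourier_neg, map_mul]
    ring
  apply Complex.ofReal_injective
  rw [← integral_complex_ofReal]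
  simp_rw [h1]
  rw [integral_finsetSum _ fun d _ => ContinuousMap.integrable_unitAddCircle (by fun_prop)]
  have h2 : ∀ d ∈ Finset.range D, ∫ x : UnitAddCircle, ∑ d' ∈ Finset.range D,
      (a d * (starRingEnd ℂ) (a d')) * fourier (m * d + -(m * d')) x = 1 := by
    intro d hd
    rw [integral_finsetSum _ fun d _ => ContinuousMap.integrable_unitAddCircle (by fun_prop)]
    rw [Finset.sum_eq_single_of_mem d hd]
    · rw [integral_const_mul, Complex.mul_conj', ha, add_neg_cancel]
      simp only [fourier_zero]
      simp
    · intro d' _ hne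
      rw [integral_const_mul, integral_fourier, mul_zero]
      rw [← sub_eq_add_neg, ← mul_sub]
      refine mul_ne_zero hm (sub_ne_zero.2 ?_)
      exact_mod_cast hne.symm
  rw [Finset.sum_congr rfl h2]
  simp

theorem integral_norm_trigonometric_sum_le {m : ℤ} (hm : m ≠ 0) {a : ℕ → ℂ} (ha : ∀ d, ‖a d‖ = 1)
    (D : ℕ) : ∫ x : UnitAddCircle, ‖∑ d ∈ Finset.range D, a d * fourier (m * d) x‖ ≤ √D := by
  rcases Nat.eq_zero_or_pos D with rfl | hD
  · simp
  have hs : 0 < √(D : ℝ) := Real.sqrt_pos.2 (by exact_mod_cast hD)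
  -- The inequality r ≤ r²/(2√D) + √D/2 takes the place of Cauchy–Schwarz.
  have h1 : ∀ x : UnitAddCircle, ‖∑ d ∈ Finset.range D, a d * fourier (m * d) x‖ ≤
      (2 * √D)⁻¹ * ‖∑ d ∈ Finset.range D, a d * fourier (m * d) x‖ ^ 2 + √D / 2 := by
    intro x
    generalize ‖∑ d ∈ Finset.range D, a d * fourier (m * d) x‖ = r
    rw [← sub_nonneg]
    have : (2 * √(D : ℝ))⁻¹ * r ^ 2 + √D / 2 - r = (2 * √(D : ℝ))⁻¹ * (r - √D) ^ 2 := by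
      field_simp
      ring
    rw [this]
    positivity
  refine (integral_mono (ContinuousMap.integrable_unitAddCircle (by fun_prop))
    (ContinuousMap.integrable_unitAddCircle (by fun_prop)) h1).trans ?_
  rw [integral_add (ContinuousMap.integrable_unitAddCircle (by fun_prop)) (integrable_const _),
    integral_const_mul, integral_norm_sq_trigonometric_sum hm ha, integral_const, probReal_univ,
    one_smul]
  have h2 : (D : ℝ) = √D * √D := (Real.mul_self_sqrt (Nat.cast_nonneg D)).symm
  apply le_of_eq
  conv_lhs => rw [h2]
  rw [Real.sqrt_mul_self hs.le]
  field_simp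
  ring

/-- For `m ≠ 0` orthogonality gives the bound D^(-1/2); for `m = 0` the sum is geometric with ratio
different from 1. -/
theorem tendsto_twistedAverageNorm_fourier {α : UnitAddCircle} {c : ℂ} (hc : ‖c‖ = 1) {m : ℤ}
    (h : m ≠ 0 ∨ ∀ l : ℤ, c * fourier l α ≠ 1) (l : ℤ) :
    Tendsto (twistedAverageNorm α c m (fourier l)) atTop (𝓝 0) := by
  have hnsmul : ∀ d : ℕ, fourier l (d • α) = fourier l α ^ d := by
    intro d
    induction d with
    | zero => simp
    | succ d ih => rw [succ_nsmul, fourier_apply_add, ih, pow_succ]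
  have hterm : ∀ (d : ℕ) (x : UnitAddCircle), fourier l (x + d • α) * charCocycle α c m d x =
      fourier l x * ((fourier l (d • α) * charCocycle α c m d 0) * fourier (m * d) x) := by
    intro d x
    rw [charCocycle_eq, fourier_apply_add]
    ring
  have heq : ∀ D, twistedAverageNorm α c m (fourier l) D = (D : ℝ)⁻¹ *
      ∫ x : UnitAddCircle, ‖∑ d ∈ Finset.range D,
        (fourier l (d • α) * charCocycle α c m d 0) * fourier (m * d) x‖ := by
    intro D
    rw [twistedAverageNorm, ← integral_const_mul]
    congr 1
    ext x
    simp_rw [hterm]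
    rw [← Finset.mul_sum, norm_mul, norm_mul, norm_fourier_apply, one_mul, norm_inv,
      Complex.norm_natCast]
  have hnn : ∀ D, 0 ≤ twistedAverageNorm α c m (fourier l) D :=
    fun D => integral_nonneg fun x => norm_nonneg _
  rcases eq_or_ne m 0 with rfl | hm
  · have hl : fourier l α * c ≠ 1 := by
      rw [mul_comm]; exact h.resolve_left (fun h => h rfl) l
    have hb : ∀ D, twistedAverageNorm α c 0 (fourier l) D ≤
        (D : ℝ)⁻¹ * (2 / ‖fourier l α * c - 1‖) := by
      intro D
      rw [heq]
      refine mul_le_mul_of_nonneg_left ?_ (by positivity)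
      have hsum : ∀ x : UnitAddCircle, ∑ d ∈ Finset.range D,
          (fourier l (d • α) * charCocycle α c 0 d 0) * fourier (0 * d) x =
          ((fourier l α * c) ^ D - 1) / (fourier l α * c - 1) := by
        intro x
        rw [← geom_sum_eq hl]
        refine Finset.sum_congr rfl fun d _ => ?_
        rw [hnsmul, zero_mul, fourier_zero, mul_one, mul_pow, charCocycle]
        simp only [fourier_zero, mul_one, Finset.prod_const, Finset.card_range]
      simp_rw [hsum]
      rw [integral_const, probReal_univ, one_smul, norm_div]
      gcongr
      refine (norm_sub_le _ _).trans ?_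
      rw [norm_pow, norm_mul, norm_fourier_apply, hc]
      norm_num
    refine squeeze_zero hnn hb ?_
    simpa using tendsto_inv_atTop_nhds_zero_nat.mul_const (2 / ‖fourier l α * c - 1‖)
  · have hb : ∀ D, twistedAverageNorm α c m (fourier l) D ≤ (√(D : ℝ))⁻¹ := by
      intro D
      rw [heq]
      refine (mul_le_mul_of_nonneg_left (integral_norm_trigonometric_sum_le hm (fun d => ?_) D)
        (by positivity)).trans (le_of_eq ?_)
      · rw [norm_mul, norm_fourier_apply, norm_charCocycle hc, one_mul]
      · rcases Nat.eq_zero_or_pos D with rfl | hD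
        · simp
        have hs : 0 < √(D : ℝ) := Real.sqrt_pos.2 (by exact_mod_cast hD)
        have h2 : (D : ℝ) = √D * √D := (Real.mul_self_sqrt (Nat.cast_nonneg D)).symm
        conv_lhs => enter [1]; rw [h2]
        field_simp
    refine squeeze_zero hnn hb ?_
    exact tendsto_inv_atTop_zero.comp (Real.tendsto_sqrt_atTop.comp tendsto_natCast_atTop_atTop)

/-- The cocycle is unimodular and Lebesgue measure is translation invariant, so the dependence on
`f` is 1-Lipschitz in L¹, uniformly in `D`. This uniformity allows approximation of `f`. -/
theorem twistedAverageNorm_le_add (α : UnitAddCircle) {c : ℂ} (hc : ‖c‖ = 1) (m : ℤ)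
    {f g : UnitAddCircle → ℂ} (hf : Continuous f) (hg : Continuous g) (D : ℕ) :
    twistedAverageNorm α c m f D ≤ twistedAverageNorm α c m g D + ∫ x, ‖f x - g x‖ := by
  have h1 : ∀ x, ‖(D : ℂ)⁻¹ * ∑ d ∈ Finset.range D, f (x + d • α) * charCocycle α c m d x‖ ≤
      ‖(D : ℂ)⁻¹ * ∑ d ∈ Finset.range D, g (x + d • α) * charCocycle α c m d x‖ +
        (D : ℝ)⁻¹ * ∑ d ∈ Finset.range D, ‖f (x + d • α) - g (x + d • α)‖ := by
    intro x
    rw [← sub_le_iff_le_add']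
    refine (norm_sub_norm_le _ _).trans ?_
    rw [← mul_sub, ← Finset.sum_sub_distrib, norm_mul, norm_inv, Complex.norm_natCast]
    refine mul_le_mul_of_nonneg_left ((norm_sum_le _ _).trans (le_of_eq ?_)) (by positivity)
    refine Finset.sum_congr rfl fun d _ => ?_
    rw [← sub_mul, norm_mul, norm_charCocycle hc, mul_one]
  refine (integral_mono (ContinuousMap.integrable_unitAddCircle (by fun_prop))
    (ContinuousMap.integrable_unitAddCircle (by fun_prop)) h1).trans ?_
  rw [integral_add (ContinuousMap.integrable_unitAddCircle (by fun_prop))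
    (ContinuousMap.integrable_unitAddCircle (by fun_prop)), integral_const_mul,
    integral_finsetSum _ fun d _ => ContinuousMap.integrable_unitAddCircle (by fun_prop)]
  refine add_le_add le_rfl ?_
  have h2 : ∀ d ∈ Finset.range D, ∫ x, ‖f (x + d • α) - g (x + d • α)‖ = ∫ x, ‖f x - g x‖ :=
    fun d _ => integral_add_right_eq_self (fun x => ‖f x - g x‖) (d • α)
  rw [Finset.sum_congr rfl h2, Finset.sum_const, Finset.card_range, nsmul_eq_mul]
  rcases Nat.eq_zero_or_pos D with rfl | hD
  · simpa using integral_nonneg fun x => norm_nonneg (f x - g x)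
  · rw [inv_mul_cancel_left₀ (by positivity)]

theorem tendsto_twistedAverageNorm {α : UnitAddCircle} {c : ℂ} (hc : ‖c‖ = 1) {m : ℤ}
    (h : m ≠ 0 ∨ ∀ l : ℤ, c * fourier l α ≠ 1) (f : C(UnitAddCircle, ℂ)) :
    Tendsto (twistedAverageNorm α c m f) atTop (𝓝 0) := by
  have hnn : ∀ (f : UnitAddCircle → ℂ) D, 0 ≤ twistedAverageNorm α c m f D :=
    fun f D => integral_nonneg fun x => norm_nonneg _
  have hspan : ∀ P ∈ Submodule.span ℂ (Set.range (fourier (T := (1 : ℝ)))),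
      Tendsto (twistedAverageNorm α c m P) atTop (𝓝 0) := by
    intro P hP
    induction hP using Submodule.span_induction with
    | mem x hx => obtain ⟨l, rfl⟩ := hx; exact tendsto_twistedAverageNorm_fourier hc h l
    | zero => simp [funext (show ∀ D, twistedAverageNorm α c m 0 D = 0 by simp [twistedAverageNorm])]
    | add P Q _ _ hP hQ =>
      refine squeeze_zero (hnn _) (fun D => ?_) (by simpa using hP.add hQ)
      unfold twistedAverageNorm
      rw [← integral_add (ContinuousMap.integrable_unitAddCircle (by fun_prop))
        (ContinuousMap.integrable_unitAddCircle (by fun_prop))]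
      refine integral_mono (ContinuousMap.integrable_unitAddCircle (by fun_prop))
        (ContinuousMap.integrable_unitAddCircle (by fun_prop)) fun x => ?_
      simp only [ContinuousMap.add_apply, add_mul, Finset.sum_add_distrib, mul_add]
      exact norm_add_le _ _
    | smul a P _ hP =>
      have : ∀ D, twistedAverageNorm α c m (a • P) D = ‖a‖ * twistedAverageNorm α c m P D := by
        intro D
        unfold twistedAverageNorm
        rw [← integral_const_mul]
        congr 1
        ext x
        rw [← norm_mul, mul_left_comm, Finset.mul_sum _ _ a]
        congr 3
        ext d
        simp only [Pi.smul_apply, smul_eq_mul]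
        ring
      have h0 := hP.const_mul ‖a‖
      rw [mul_zero] at h0
      exact h0.congr fun D => (this D).symm
  rw [Metric.tendsto_atTop]
  intro ε hε
  have hmem : f ∈ (Submodule.span ℂ (Set.range (fourier (T := (1 : ℝ))))).topologicalClosure := by
    rw [span_fourier_closure_eq_top]; trivial
  obtain ⟨P, hP, hfP⟩ := Metric.mem_closure_iff.1 hmem (ε / 2) (half_pos hε)
  obtain ⟨N, hN⟩ := Metric.tendsto_atTop.1 (hspan P hP) (ε / 2) (half_pos hε)
  refine ⟨N, fun D hD => ?_⟩
  have h1 := hN D hD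
  rw [Real.dist_eq, sub_zero, abs_of_nonneg (hnn _ _)] at h1 ⊢
  have h2 := twistedAverageNorm_le_add α hc m f.continuous P.continuous D
  have h3 : ∫ x, ‖f x - P x‖ ≤ ∫ x : UnitAddCircle, dist f P :=
    integral_mono (ContinuousMap.integrable_unitAddCircle (by fun_prop)) (integrable_const _)
      fun x => by
        have := ContinuousMap.dist_apply_le_dist (f := f) (g := P) x
        rwa [dist_eq_norm] at this
  rw [integral_const, probReal_univ, one_smul] at h3
  linarith

theorem norm_fourier_coe_sub_le (k : ℤ) (a b : ℝ) :
    ‖fourier k (a : UnitAddCircle) - fourier k (b : UnitAddCircle)‖ ≤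
      2 * Real.pi * |(k : ℝ)| * |a - b| := by
  have h : ∀ r : ℝ, fourier k (r : UnitAddCircle) =
      Complex.exp (Complex.I * ((2 * Real.pi * k * r : ℝ) : ℂ)) := by
    intro r
    rw [fourier_coe_apply]
    congr 1
    push_cast
    ring
  have h1 : fourier k (a : UnitAddCircle) - fourier k (b : UnitAddCircle) =
      fourier k (b : UnitAddCircle) * (fourier k ((a - b : ℝ) : UnitAddCircle) - 1) := by
    rw [mul_sub, ← fourier_apply_add, ← AddCircle.coe_add]
    simp
  rw [h1, norm_mul, norm_fourier_apply, one_mul, h]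
  refine (Real.norm_exp_I_mul_ofReal_sub_one_le).trans (le_of_eq ?_)
  rw [Real.norm_eq_abs, abs_mul, abs_mul, abs_of_pos Real.two_pi_pos]

/-- With `h` replaced by the coboundary of `G'`, the cocycle becomes e(kG'(x + dα)) up to a
unimodular factor independent of `d`, and e(kG') is L¹-close to e(kG). The threshold for `D` must
come from `G` alone, because `G'` is chosen after `D`. -/
theorem tendsto_integral_norm_average_cocycle {α : UnitAddCircle} {c : ℂ} (hc : ‖c‖ = 1) {m : ℤ}
    (hcm : m ≠ 0 ∨ ∀ l : ℤ, c * fourier l α ≠ 1) (k : ℤ) {h : C(UnitAddCircle, ℝ)}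
    (hh : ∀ ε > 0, ∃ G : C(UnitAddCircle, ℝ), ∀ δ > 0, ∃ G' : C(UnitAddCircle, ℝ),
        ∫ x, |G' x - G x| ≤ ε ∧ ∀ x, |h x - (G' (x + α) - G' x)| ≤ δ) :
    Tendsto (fun D : ℕ => ∫ x, ‖(D : ℂ)⁻¹ * ∑ d ∈ Finset.range D,
      fourier k ((∑ i ∈ Finset.range d, h (x + i • α) : ℝ) : UnitAddCircle) *
        charCocycle α c m d x‖) atTop (𝓝 0) := by
  have hcoe : Continuous ((↑) : ℝ → UnitAddCircle) := AddCircle.continuous_mk' 1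
  rw [Metric.tendsto_atTop]
  intro ε hε
  set L := 2 * Real.pi * |(k : ℝ)| with hL
  have hL0 : 0 ≤ L := by positivity
  -- Two errors, each at most `L` times this quantity, stay below ε/4 each; `L + 1` covers the case
  -- k = 0.
  have hε' : 0 < ε / (4 * (L + 1)) := by positivity
  obtain ⟨G, hG⟩ := hh _ hε'
  let f : C(UnitAddCircle, ℝ) → C(UnitAddCircle, ℂ) := fun G =>
    ⟨fun x => fourier k (G x : UnitAddCircle), by fun_prop⟩
  obtain ⟨N, hN⟩ := Metric.tendsto_atTop.1 (tendsto_twistedAverageNorm hc hcm (f G)) (ε / 2)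
    (half_pos hε)
  refine ⟨N, fun D hD => ?_⟩
  -- The precision depends on `D`, since up to `D` errors are summed.
  obtain ⟨G', hG'1, hG'2⟩ := hG (ε / (4 * (L + 1)) / (D + 1)) (by positivity)
  have h1 := (le_abs_self _).trans_lt (hN D hD)
  rw [Real.dist_eq, sub_zero, abs_of_nonneg (integral_nonneg fun x => norm_nonneg _)]
  rw [sub_zero] at h1
  have h2 := twistedAverageNorm_le_add α hc m (f G').continuous (f G).continuous D
  have h3 : ∫ x, ‖f G' x - f G x‖ ≤ L * (ε / (4 * (L + 1))) := by
    refine (integral_mono (g := fun x => L * |G' x - G x|)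
      (ContinuousMap.integrable_unitAddCircle (by fun_prop))
      (ContinuousMap.integrable_unitAddCircle (by fun_prop))
      fun x => norm_fourier_coe_sub_le k _ _).trans ?_
    rw [integral_const_mul]
    exact mul_le_mul_of_nonneg_left hG'1 hL0
  have h4 : ∀ x, ‖(D : ℂ)⁻¹ * ∑ d ∈ Finset.range D,
      fourier k ((∑ i ∈ Finset.range d, h (x + i • α) : ℝ) : UnitAddCircle) *
        charCocycle α c m d x‖ ≤
      ‖(D : ℂ)⁻¹ * ∑ d ∈ Finset.range D, f G' (x + d • α) * charCocycle α c m d x‖ +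
        L * (ε / (4 * (L + 1))) := by
    intro x
    have hrot : ‖(D : ℂ)⁻¹ * ∑ d ∈ Finset.range D, f G' (x + d • α) * charCocycle α c m d x‖ =
        ‖(D : ℂ)⁻¹ * ∑ d ∈ Finset.range D,
          fourier k ((G' (x + d • α) - G' x : ℝ) : UnitAddCircle) * charCocycle α c m d x‖ := by
      have : ∀ d : ℕ, f G' (x + d • α) * charCocycle α c m d x = fourier k (G' x : UnitAddCircle) *
          (fourier k ((G' (x + d • α) - G' x : ℝ) : UnitAddCircle) * charCocycle α c m d x) := by
        intro d
        rw [← mul_assoc, ← fourier_apply_add, ← AddCircle.coe_add, add_sub_cancel]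
        rfl
      simp_rw [this]
      rw [← Finset.mul_sum, mul_left_comm, norm_mul, norm_fourier_apply, one_mul]
    rw [hrot, ← sub_le_iff_le_add']
    refine (norm_sub_norm_le _ _).trans ?_
    rw [← mul_sub, ← Finset.sum_sub_distrib]
    refine norm_average_le (by positivity) fun d hd => ?_
    rw [← sub_mul, norm_mul, norm_charCocycle hc, mul_one]
    refine (norm_fourier_coe_sub_le k _ _).trans (mul_le_mul_of_nonneg_left ?_ hL0)
    refine (abs_sum_le_of_abs_sub_coboundary_le hG'2 d x).trans ?_
    rw [mul_div_assoc', div_le_iff₀ (by positivity), mul_comm]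
    have : (d : ℝ) ≤ D := by exact_mod_cast hd.le
    exact mul_le_mul_of_nonneg_left (by linarith) hε'.le
  have h5 := integral_mono (μ := (volume : Measure UnitAddCircle))
    (ContinuousMap.integrable_unitAddCircle (by fun_prop))
    (ContinuousMap.integrable_unitAddCircle (by fun_prop)) h4
  rw [integral_add (ContinuousMap.integrable_unitAddCircle (by fun_prop)) (integrable_const _),
    integral_const, probReal_univ, one_smul] at h5
  have h6 : L * (ε / (4 * (L + 1))) < ε / 4 := by
    rw [mul_div_assoc', div_lt_div_iff₀ (by positivity) (by norm_num)]
    nlinarith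
  unfold twistedAverageNorm at h1 h2
  linarith

end ErgodicSums

/-! ### The torus flow, its self-joining and its enveloping semigroup -/

section TorusMap

theorem int_eq_zero_of_linearIndependent {α β : ℝ}
    (hlin : LinearIndependent ℚ ![(1 : ℝ), α, β]) {a b : ℤ}
    (h : a • (α : UnitAddCircle) + b • (β : UnitAddCircle) = 0) : a = 0 ∧ b = 0 := by
  rw [← AddCircle.coe_zsmul, ← AddCircle.coe_zsmul, ← AddCircle.coe_add,
    AddCircle.coe_eq_zero_iff] at h
  obtain ⟨n, hn⟩ := h
  have h0 := Fintype.linearIndependent_iff.1 hlin ![-(n : ℚ), a, b] (by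
    simp only [Fin.sum_univ_three, Matrix.cons_val_zero, Matrix.cons_val_one, Matrix.cons_val,
      Rat.smul_def]
    push_cast
    simp only [zsmul_eq_mul] at hn
    linarith)
  exact ⟨by simpa using h0 1, by simpa using h0 2⟩

theorem exists_linearIndependent_one : ∃ α β : ℝ, LinearIndependent ℚ ![(1 : ℝ), α, β] := by
  have hrank : ∀ n : ℕ, (n : Cardinal) < Module.rank ℚ ℝ := fun n => by
    rw [Real.rank_rat_real]; exact Cardinal.nat_lt_continuum n
  obtain ⟨α, hα⟩ := exists_linearIndependent_snoc_of_lt_rank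
    (v := ![(1 : ℝ)]) (LinearIndependent.of_subsingleton 0 one_ne_zero) (hrank 1)
  obtain ⟨β, hβ⟩ := exists_linearIndependent_snoc_of_lt_rank hα (hrank 2)
  refine ⟨α, β, ?_⟩
  have heq : ![(1 : ℝ), α, β] = Fin.snoc (α := fun _ => ℝ) (Fin.snoc (α := fun _ => ℝ) ![1] α) β := by
    ext i
    fin_cases i <;> rfl
  rw [heq]
  exact hβ

namespace TopFlow

variable {α β : ℝ} {h : C(UnitAddCircle, ℝ)} {φ : C(UnitAddCircle, UnitAddCircle)}

theorem torusMap_apply (w : UnitAddCircle × UnitAddCircle × UnitAddCircle) :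
    torusMap α φ w = (w.1 + (α : UnitAddCircle), w.2.1 + φ w.1, w.2.2 + w.1) := rfl

theorem torusMap_iterate_fst (n : ℕ) (w : UnitAddCircle × UnitAddCircle × UnitAddCircle) :
    ((torusMap α φ)^[n] w).1 = w.1 + n • (α : UnitAddCircle) := by
  induction n with
  | zero => simp
  | succ n ih =>
    rw [Function.iterate_succ_apply', torusMap_apply, ih, succ_nsmul, add_assoc]

/-- The multiplier depends only on the first coordinate, whose distribution is known for every
invariant measure. -/
theorem torusChar_torusMap_iterate
    (hφ : ∀ x : UnitAddCircle, φ x = ((h x + β : ℝ) : UnitAddCircle)) (i : ℤ × ℤ × ℤ) (d : ℕ)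
    (w : UnitAddCircle × UnitAddCircle × UnitAddCircle) :
    torusChar i ((torusMap α φ)^[d] w) = torusChar i w *
      (fourier i.2.1 ((∑ r ∈ Finset.range d, h (w.1 + r • (α : UnitAddCircle)) : ℝ) :
          UnitAddCircle) *
        charCocycle α (fourier i.1 (α : UnitAddCircle) * fourier i.2.1 (β : UnitAddCircle))
          i.2.2 d w.1) := by
  induction d with
  | zero =>
    rw [Finset.sum_range_zero, charCocycle, Finset.prod_range_zero, AddCircle.coe_zero,
      fourier_eval_zero, mul_one, mul_one, Function.iterate_zero_apply]
  | succ d ih =>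
    have hstep : ∀ v, torusChar i (torusMap α φ v) = torusChar i v *
        (fourier i.1 (α : UnitAddCircle) * fourier i.2.1 (β : UnitAddCircle) *
          fourier i.2.2 v.1 * fourier i.2.1 (h v.1 : UnitAddCircle)) := by
      intro v
      change fourier i.1 (v.1 + (α : UnitAddCircle)) *
        (fourier i.2.1 (v.2.1 + φ v.1) * fourier i.2.2 (v.2.2 + v.1)) =
        fourier i.1 v.1 * (fourier i.2.1 v.2.1 * fourier i.2.2 v.2.2) * _
      rw [hφ, AddCircle.coe_add]
      simp only [fourier_apply_add]
      ring
    rw [Function.iterate_succ_apply', hstep, ih, torusMap_iterate_fst, Finset.sum_range_succ,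
      charCocycle, charCocycle, Finset.prod_range_succ, AddCircle.coe_add]
    simp only [fourier_apply_add]
    ring

/-- Averaging over iterates bounds the integral of a character nontrivial in (y, z) by the Lebesgue
L¹ norm of an averaged cocycle, which tends to 0. Characters of x alone are settled by unique
ergodicity of the rotation. -/
theorem eq_volume_of_torusMap_invariant (hlin : LinearIndependent ℚ ![(1 : ℝ), α, β])
    (hh : ∀ ε > 0, ∃ G : C(UnitAddCircle, ℝ), ∀ δ > 0, ∃ G' : C(UnitAddCircle, ℝ),
        ∫ x, |G' x - G x| ≤ ε ∧ ∀ x, |h x - (G' (x + (α : UnitAddCircle)) - G' x)| ≤ δ)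
    (hφ : ∀ x : UnitAddCircle, φ x = ((h x + β : ℝ) : UnitAddCircle))
    {μ : Measure (UnitAddCircle × UnitAddCircle × UnitAddCircle)} [IsProbabilityMeasure μ]
    (hμ : MeasurePreserving (torusMap α φ) μ μ) : μ = volume := by
  have hα : ∀ n : ℤ, n • (α : UnitAddCircle) = 0 → n = 0 := fun n hn =>
    (int_eq_zero_of_linearIndependent hlin (a := n) (b := 0) (by simpa using hn)).1
  have hfst : MeasurePreserving Prod.fst μ volume := by
    refine ⟨measurable_fst, ?_⟩
    have : IsProbabilityMeasure (μ.map Prod.fst) :=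
      Measure.isProbabilityMeasure_map measurable_fst.aemeasurable
    refine eq_volume_of_rotation_invariant hα ⟨measurable_add_const _, ?_⟩
    rw [Measure.map_map (measurable_add_const _) measurable_fst]
    conv_rhs => rw [← hμ.map_eq, Measure.map_map measurable_fst hμ.measurable]
    rfl
  have hint : ∀ {E : Type} [NormedAddCommGroup E]
      {f : UnitAddCircle × UnitAddCircle × UnitAddCircle → E}, Continuous f → Integrable f μ :=
    fun hf => hf.integrable_of_hasCompactSupport (HasCompactSupport.of_compactSpace _)
  refine eq_volume_of_integral_torusChar fun i hi => ?_
  by_cases hi2 : i.2 = 0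
  · have hi1 : i.1 ≠ 0 := fun h1 => hi (Prod.ext h1 hi2)
    have : ∀ w, torusChar i w = fourier i.1 w.1 := by
      intro w
      change fourier i.1 w.1 * (fourier i.2.1 w.2.1 * fourier i.2.2 w.2.2) = _
      rw [hi2]
      change fourier i.1 w.1 * (fourier 0 w.2.1 * fourier 0 w.2.2) = _
      rw [fourier_zero, fourier_zero, mul_one, mul_one]
    simp_rw [this]
    rw [← integral_fourier hi1, ← hfst.map_eq, integral_map measurable_fst.aemeasurable
      (fourier i.1).continuous.aestronglyMeasurable]
  set c : ℂ := fourier i.1 (α : UnitAddCircle) * fourier i.2.1 (β : UnitAddCircle) with hc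
  have hc1 : ‖c‖ = 1 := by rw [hc, norm_mul, norm_fourier_apply, norm_fourier_apply, one_mul]
  have hcm : i.2.2 ≠ 0 ∨ ∀ l : ℤ, c * fourier l (α : UnitAddCircle) ≠ 1 := by
    by_cases h2 : i.2.2 = 0
    -- Ratio 1 would be an integer relation between 1, α and β, forcing the y-frequency to vanish
    -- together with the z-frequency.
    · refine Or.inr fun l hl => hi2 ?_
      have h3 : fourier 1 ((i.1 + l) • (α : UnitAddCircle) + i.2.1 • (β : UnitAddCircle)) = 1 := by
        rw [← hl, hc, fourier_apply_add, mul_right_comm, ← fourier_add]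
        simp only [fourier_apply, one_smul]
      rw [fourier_eq_one_iff, one_smul] at h3
      exact Prod.ext (int_eq_zero_of_linearIndependent hlin h3).2 h2
    · exact Or.inl h2
  have hlim := tendsto_integral_norm_average_cocycle hc1 hcm i.2.1 hh
  set Ψ : ℕ → UnitAddCircle → ℂ := fun d x =>
    fourier i.2.1 ((∑ r ∈ Finset.range d, h (x + r • (α : UnitAddCircle)) : ℝ) :
      UnitAddCircle) * charCocycle α c i.2.2 d x with hΨ
  have hcoe : Continuous ((↑) : ℝ → UnitAddCircle) := AddCircle.continuous_mk' 1
  have hΨc : ∀ d, Continuous (Ψ d) := fun d => by fun_prop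
  have hmean : ∀ D : ℕ, 0 < D → ∫ w, torusChar i w ∂μ =
      ∫ w, torusChar i w * ((D : ℂ)⁻¹ * ∑ d ∈ Finset.range D, Ψ d w.1) ∂μ := by
    intro D hD
    have h1 : ∀ d ∈ Finset.range D, ∫ w, torusChar i w * Ψ d w.1 ∂μ = ∫ w, torusChar i w ∂μ := by
      intro d _
      simp_rw [show ∀ w, torusChar i w * Ψ d w.1 = torusChar i ((torusMap α φ)^[d] w) from
        fun w => (torusChar_torusMap_iterate hφ i d w).symm]
      have := (hμ.iterate d).map_eq
      conv_rhs => rw [← this]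
      rw [integral_map (hμ.iterate d).measurable.aemeasurable
        (torusChar i).continuous.aestronglyMeasurable]
    simp_rw [mul_left_comm _ ((D : ℂ)⁻¹), Finset.mul_sum]
    simp_rw [← Finset.mul_sum _ _ ((D : ℂ)⁻¹)]
    rw [integral_const_mul, integral_finsetSum _ fun d _ => hint (by fun_prop),
      Finset.sum_congr rfl h1, Finset.sum_const, Finset.card_range, nsmul_eq_mul,
      inv_mul_cancel_left₀ (by exact_mod_cast hD.ne')]
  have hnorm : ∀ w, ‖torusChar i w‖ = 1 := by
    intro w
    change ‖fourier i.1 w.1 * (fourier i.2.1 w.2.1 * fourier i.2.2 w.2.2)‖ = 1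
    rw [norm_mul, norm_mul, norm_fourier_apply, norm_fourier_apply, norm_fourier_apply, one_mul,
      one_mul]
  rw [← norm_le_zero_iff]
  refine ge_of_tendsto hlim ?_
  filter_upwards [eventually_gt_atTop 0] with D hD
  rw [hmean D hD]
  refine (norm_integral_le_integral_norm _).trans (le_of_eq ?_)
  simp_rw [norm_mul (torusChar i _), hnorm, one_mul]
  conv_rhs => rw [← hfst.map_eq]
  rw [integral_map measurable_fst.aemeasurable (Continuous.aestronglyMeasurable (by fun_prop))]

theorem isStrictlyErgodic_torusMap (hlin : LinearIndependent ℚ ![(1 : ℝ), α, β])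
    (hh : ∀ ε > 0, ∃ G : C(UnitAddCircle, ℝ), ∀ δ > 0, ∃ G' : C(UnitAddCircle, ℝ),
        ∫ x, |G' x - G x| ≤ ε ∧ ∀ x, |h x - (G' (x + (α : UnitAddCircle)) - G' x)| ≤ δ)
    (hφ : ∀ x : UnitAddCircle, φ x = ((h x + β : ℝ) : UnitAddCircle)) :
    IsStrictlyErgodic (torusMap α φ) := by
  have huniq : ∀ ν : Measure (UnitAddCircle × UnitAddCircle × UnitAddCircle),
      IsProbabilityMeasure ν ∧ ν.Regular ∧ MeasurePreserving (torusMap α φ) ν ν → ν = volume :=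
    fun ν hν => by
      have := hν.1
      exact eq_volume_of_torusMap_invariant hlin hh hφ hν.2.2
  exact ⟨isUniquelyErgodic_of_unique huniq, isMinimal_of_unique huniq⟩

/-- A flow with a point whose averages are the oscillating averages `cosAverage` is not uniquely
ergodic. -/
theorem not_isStrictlyErgodic_of_cosAverage {X : Type*} [TopologicalSpace X] [CompactSpace X]
    [T2Space X] {T : X ≃ₜ X} {a : UnitAddCircle} (hpos : ∀ M, ∃ N ≥ M, 1 / 2 ≤ cosAverage a h N)
    (hneg : ∀ M, ∃ N ≥ M, cosAverage a h N ≤ -(1 / 2)) {f : X → ℝ} (hf : Continuous f) {x : X}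
    (hfx : ∀ n : ℕ, f (T^[n] x) = Real.cos (2 * Real.pi * ∑ i ∈ Finset.range n, h (i • a))) :
    ¬ IsStrictlyErgodic T := by
  rintro ⟨hT, -⟩
  obtain ⟨c, hc⟩ := hT.exists_tendsto ⟨f, hf⟩
  have hlim : Tendsto (cosAverage a h) atTop (𝓝 c) := by
    refine (hc x).congr fun n => ?_
    simp only [birkhoffAverage, birkhoffSum, ContinuousMap.coe_mk, hfx, cosAverage, smul_eq_mul]
  have h1 : 1 / 2 ≤ c := by
    by_contra! hlt
    obtain ⟨M, hM⟩ := eventually_atTop.1 (hlim.eventually (gt_mem_nhds hlt))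
    obtain ⟨N, hN, hN'⟩ := hpos M
    exact (hM N hN).not_ge hN'
  have h2 : c ≤ -(1 / 2) := by
    by_contra! hlt
    obtain ⟨M, hM⟩ := eventually_atTop.1 (hlim.eventually (lt_mem_nhds hlt))
    obtain ⟨N, hN, hN'⟩ := hneg M
    exact (hM N hN).not_ge hN'
  linarith

/-- The function `cos (2π (y - (z' - z)))` on pairs of points of the torus. -/
noncomputable def pairCos (p : (UnitAddCircle × UnitAddCircle × UnitAddCircle) ×
    (UnitAddCircle × UnitAddCircle × UnitAddCircle)) : ℝ :=
  (fourier 1 (p.1.2.1 - (p.2.2.2 - p.1.2.2))).re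

@[fun_prop]
theorem continuous_pairCos : Continuous pairCos := by
  unfold pairCos
  fun_prop

/-- The offset β between the base points makes z' - z grow by β at each step, cancelling the drift
of y and leaving the ergodic sum of `h`. -/
theorem pairCos_iterate (hφ : ∀ x : UnitAddCircle, φ x = ((h x + β : ℝ) : UnitAddCircle))
    (n : ℕ) : pairCos ((torusMap α φ)^[n] (0, 0, 0),
      (torusMap α φ)^[n] ((β : UnitAddCircle), 0, 0)) =
      Real.cos (2 * Real.pi * ∑ i ∈ Finset.range n, h (i • (α : UnitAddCircle))) := by
  have key : ((torusMap α φ)^[n] (0, 0, 0)).2.1 -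
      (((torusMap α φ)^[n] ((β : UnitAddCircle), 0, 0)).2.2 -
        ((torusMap α φ)^[n] (0, 0, 0)).2.2) =
      ((∑ i ∈ Finset.range n, h (i • (α : UnitAddCircle)) : ℝ) : UnitAddCircle) := by
    induction n with
    | zero => simp
    | succ n ih =>
      rw [Function.iterate_succ_apply', Function.iterate_succ_apply', Finset.sum_range_succ,
        AddCircle.coe_add, ← ih]
      simp only [torusMap_apply, torusMap_iterate_fst, hφ, zero_add, AddCircle.coe_add]
      abel
  rw [pairCos, key, fourier_coe_apply]
  have : 2 * (Real.pi : ℂ) * Complex.I * ((1 : ℤ) : ℂ) *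
      ((∑ i ∈ Finset.range n, h (i • (α : UnitAddCircle)) : ℝ) : ℂ) / ((1 : ℝ) : ℂ) =
      ((2 * Real.pi * ∑ i ∈ Finset.range n, h (i • (α : UnitAddCircle)) : ℝ) : ℂ) * Complex.I := by
    push_cast
    ring
  rw [this, Complex.exp_ofReal_mul_I_re]

theorem isMinimal_supFlow_of_isDistal {Z W : Type*} [MetricSpace Z] [MetricSpace W]
    [CompactSpace Z] [CompactSpace W] {T : Z ≃ₜ Z} {R : W ≃ₜ W} (hT : IsDistal T) (hR : IsDistal R)
    (z : Z) (w : W) : IsMinimal (supFlow T z R w) :=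
  isMinimal_orbitFlow_of_injective (fun _ hp => (hT.prodCongr hR).injective hp) (z, w)

theorem not_isStrictlyErgodic_supFlow
    (hφ : ∀ x : UnitAddCircle, φ x = ((h x + β : ℝ) : UnitAddCircle))
    (hpos : ∀ M, ∃ N ≥ M, 1 / 2 ≤ cosAverage α h N)
    (hneg : ∀ M, ∃ N ≥ M, cosAverage α h N ≤ -(1 / 2)) :
    ¬ IsStrictlyErgodic (supFlow (torusMap α φ) (0, 0, 0)
      (torusMap α φ) ((β : UnitAddCircle), 0, 0)) := by
  have : CompactSpace (supSpace (torusMap α φ) (0, 0, 0)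
      (torusMap α φ) ((β : UnitAddCircle), 0, 0)) :=
    isCompact_iff_compactSpace.1 isClosed_closure.isCompact
  refine not_isStrictlyErgodic_of_cosAverage hpos hneg
    (continuous_pairCos.comp continuous_subtype_val)
    (x := ⟨((0, 0, 0), ((β : UnitAddCircle), 0, 0)), subset_closure ⟨0, rfl⟩⟩) fun n => ?_
  rw [← pairCos_iterate hφ, Function.comp_apply]
  congr 1
  have hsemi : Function.Semiconj Subtype.val (supFlow (torusMap α φ) (0, 0, 0)
      (torusMap α φ) ((β : UnitAddCircle), 0, 0)) (Prod.map (torusMap α φ) (torusMap α φ)) :=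
    fun _ => rfl
  rw [hsemi.iterate_right n, Prod.map_iterate]
  rfl

/-- Evaluation at the two base points sends the orbit of the identity to the orbit used in the
self-joining. -/
theorem not_isStrictlyErgodic_envelopingFlow
    (hφ : ∀ x : UnitAddCircle, φ x = ((h x + β : ℝ) : UnitAddCircle))
    (hpos : ∀ M, ∃ N ≥ M, 1 / 2 ≤ cosAverage α h N)
    (hneg : ∀ M, ∃ N ≥ M, cosAverage α h N ≤ -(1 / 2)) :
    ¬ IsStrictlyErgodic (envelopingFlow (torusMap α φ)) := by
  have : CompactSpace (envelopingSemigroup (torusMap α φ)) :=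
    isCompact_iff_compactSpace.1 (isCompact_envelopingSemigroup _)
  refine not_isStrictlyErgodic_of_cosAverage hpos hneg
    (f := fun p => pairCos (p.1 (0, 0, 0), p.1 ((β : UnitAddCircle), 0, 0)))
    (continuous_pairCos.comp (((continuous_apply _).comp continuous_subtype_val).prodMk
      ((continuous_apply _).comp continuous_subtype_val)))
    (x := ⟨id, zpow_mem_envelopingSemigroup _ 0⟩) fun n => ?_
  rw [← pairCos_iterate hφ]
  have hsemi : ∀ w, Function.Semiconj (fun p : envelopingSemigroup (torusMap α φ) => p.1 w)
      (envelopingFlow (torusMap α φ)) (torusMap α φ) := fun _ _ => rfl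
  have h1 := fun w => (hsemi w).iterate_right n ⟨id, zpow_mem_envelopingSemigroup _ 0⟩
  congr 1
  exact Prod.ext (h1 _) (h1 _)

end TopFlow

end TorusMap

theorem corollary4p2 :
    ∃ (α β : ℝ) (h : C(UnitAddCircle, ℝ)) (φ : C(UnitAddCircle, UnitAddCircle)),
      LinearIndependent ℚ ![(1 : ℝ), α, β] ∧
      (∀ x : UnitAddCircle, φ x = ((h x + β : ℝ) : UnitAddCircle)) ∧
      TopFlow.IsDistal (TopFlow.torusMap α φ) ∧
      TopFlow.IsStrictlyErgodic (TopFlow.torusMap α φ) ∧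
      TopFlow.IsMinimal (TopFlow.supFlow (TopFlow.torusMap α φ) (0, 0, 0)
        (TopFlow.torusMap α φ) ((β : UnitAddCircle), 0, 0)) ∧
      ¬ TopFlow.IsStrictlyErgodic (TopFlow.supFlow (TopFlow.torusMap α φ) (0, 0, 0)
        (TopFlow.torusMap α φ) ((β : UnitAddCircle), 0, 0)) ∧
      TopFlow.IsCompositionGroup (TopFlow.envelopingSemigroup (TopFlow.torusMap α φ)) ∧
      ¬ TopFlow.IsStrictlyErgodic (TopFlow.envelopingFlow (TopFlow.torusMap α φ)) := by
  obtain ⟨α, β, hlin⟩ := exists_linearIndependent_one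
  obtain ⟨h, hh, hpos, hneg⟩ := exists_limit_of_coboundaries (α := (α : UnitAddCircle))
    fun n hn =>
      (int_eq_zero_of_linearIndependent hlin (a := n) (b := 0) (by simpa using hn)).1
  have hcoe : Continuous ((↑) : ℝ → UnitAddCircle) := AddCircle.continuous_mk' 1
  let φ : C(UnitAddCircle, UnitAddCircle) := ⟨fun x => ((h x + β : ℝ) : UnitAddCircle), by fun_prop⟩
  have hφ : ∀ x : UnitAddCircle, φ x = ((h x + β : ℝ) : UnitAddCircle) := fun _ => rfl
  have hdistal := TopFlow.isDistal_torusMap α φ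
  exact ⟨α, β, h, φ, hlin, hφ, hdistal, TopFlow.isStrictlyErgodic_torusMap hlin hh hφ,
    TopFlow.isMinimal_supFlow_of_isDistal hdistal hdistal _ _,
    TopFlow.not_isStrictlyErgodic_supFlow hφ hpos hneg,
    TopFlow.isCompositionGroup_of_injective fun _ hp => hdistal.injective hp,
    TopFlow.not_isStrictlyErgodic_envelopingFlow hφ hpos hneg⟩
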